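/- Let $\mathbb T^n=\mathbb R^n/\mathbb Z^n$ with Lebesgue measure of total mass one, identified with $[-1/2,1/2)^n$, and let $$\phi_t(x)=(4\pi t)^{-n/2}\sum_{k\in\mathbb Z^n}e^{-|x+k|^2/(4t)},\qquad t>0,\ x\in\mathbb T^n .$$ A weight is a measurable function $w:\mathbb T^n\to\mathbb R$ with $w>0$ almost everywhere. For $1\le p<\infty$, $L^p_w(\mathbb T^n)$ is the space of measurable $f$ with $\|f\|_{L^p_w}=\|f w^{1/p}\|_{L^p(\mathbb T^n)}<\infty$. For $f:\mathbb T^n\to\mathbb C$ put $\phi_t*f(x)=\int_{\mathbb T^n}\phi_t(x-y)f(y)\,dy$, which is called finite at $x$ if the integral converges absolutely, and put $$H^*_Rf(x)=\sup_{0<t<R}|\phi_t*f(x)|\in[0,\infty],$$ where $|\phi_t*f(x)|$ is read as $\infty$ if $\phi_t*f$ is not finite at $x$. Let $1\le p<\infty$, $\frac1p+\frac1{p'}=1$, and let $v$ be a weight on $\mathbb T^n$. Then the following are equivalent. 1. $v\in D^T_p$, that is, there is $t_0>0$ such that $v^{-1/p}\phi_{t_0}\in L^{p'}(\mathbb T^n)$.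 2. There are $0<R<\frac12$ and a weight $u$ on $\mathbb T^n$ such that $H^*_R$ maps $L^p_v(\mathbb T^n)$ boundedly into $L^p_u(\mathbb T^n)$ if $p>1$, and $L^1_v(\mathbb T^n)$ boundedly into weak $L^1_u(\mathbb T^n)$ if $p=1$; that is, $H^*_Rf$ is measurable for every $f\in L^p_v(\mathbb T^n)$, and there is a constant $C<\infty$, independent of $f$, such that for every such $f$ one has $\|H^*_Rf\|_{L^p_u}\le C\|f\|_{L^p_v}$ if $p>1$, and $\lambda\int_{\{H^*_Rf>\lambda\}}u\,dx\le C\|f\|_{L^1_v}$ for all $\lambda>0$ if $p=1$. 3. There is $0<R<\frac12$ such that for every $f\in L^p_v(\mathbb T^n)$ the convolution $\phi_R*f$ is finite almost everywhere and $\lim_{t\to0^+}\phi_t*f(x)=f(x)$ for almost every $x$. 4. There is $0<R<\frac12$ such that for every $f\in L^p_v(\mathbb T^n)$ one has $H^*_Rf(x)<\infty$ for almost every $x$. -/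

import Mathlib

open MeasureTheory Filter Topology
open scoped ENNReal NNReal

namespace TorusHeat

noncomputable section

/-- The torus `ℝⁿ / ℤⁿ`. Its `volume` is Lebesgue measure on the unit cube, of total mass one. -/
abbrev Torus (n : ℕ) : Type := UnitAddTorus (Fin n)

/-- The representative in the cube `[-1/2, 1/2)ⁿ` of a point of the torus. -/
def cubeRep {n : ℕ} (x : Torus n) (i : Fin n) : ℝ :=
  (AddCircle.equivIco (1 : ℝ) (-1 / 2) (x i) : ℝ)

/-- The heat kernel `φ_t(x) = (4πt)^{-n/2} ∑_{k ∈ ℤⁿ} exp(-|x + k|² / (4t))` on the torus. The sum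
runs over all translates by the lattice, so it does not depend on the chosen representative. -/
def heatKernel {n : ℕ} (t : ℝ) (x : Torus n) : ℝ :=
  (4 * Real.pi * t) ^ (-(n : ℝ) / 2) *
    ∑' k : Fin n → ℤ, Real.exp (-(∑ i, (cubeRep x i + (k i : ℝ)) ^ 2) / (4 * t))

/-- The integral defining `(φ_t * f)(x)` converges absolutely, that is, `(φ_t * |f|)(x) < ∞`. -/
def HeatConvFinite {n : ℕ} (t : ℝ) (f : Torus n → ℂ) (x : Torus n) : Prop :=
  Integrable (fun y => (heatKernel t (x - y) : ℂ) * f y) volume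

/-- The convolution `(φ_t * f)(x) = ∫ φ_t(x - y) f(y) dy` on the torus. -/
def heatConv {n : ℕ} (t : ℝ) (f : Torus n → ℂ) (x : Torus n) : ℂ :=
  ∫ y, (heatKernel t (x - y) : ℂ) * f y

open Classical in
/-- The local heat maximal operator `H*_R f(x) = sup_{0 < t < R} |(φ_t * f)(x)|`, with values in
`[0, ∞]`. A convolution whose integral does not converge absolutely counts as infinite (and not as
zero, the default value of the Bochner integral). -/
def heatMaximal {n : ℕ} (R : ℝ) (f : Torus n → ℂ) (x : Torus n) : ℝ≥0∞ :=
  ⨆ t ∈ Set.Ioo (0 : ℝ) R, if HeatConvFinite t f x then ‖heatConv t f x‖ₑ else ∞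

/-- A weight: a (Lebesgue) measurable function that is strictly positive and finite a.e. -/
def IsWeight {n : ℕ} (w : Torus n → ℝ) : Prop :=
  AEMeasurable w volume ∧ ∀ᵐ x, 0 < w x

/-- The norm `‖g‖_{L^p_w} = ‖g w^{1/p}‖_{L^p}`, for complex-valued or `[0, ∞]`-valued `g`. -/
def weightedNorm {n : ℕ} {E : Type*} [ENorm E] (p : ℝ) (w : Torus n → ℝ) (g : Torus n → E) :
    ℝ≥0∞ :=
  eLpNorm (fun x => ‖g x‖ₑ * ENNReal.ofReal (w x ^ (1 / p))) (ENNReal.ofReal p) volume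

/-- Membership in the weighted Lebesgue space `L^p_w`. -/
def MemWeightedLp {n : ℕ} {E : Type*} [ENorm E] [TopologicalSpace E] (p : ℝ) (w : Torus n → ℝ)
    (g : Torus n → E) : Prop :=
  AEStronglyMeasurable g volume ∧ weightedNorm p w g < ∞

/-- The measure `w(x) dx`. -/
def weightMeasure {n : ℕ} (w : Torus n → ℝ) : Measure (Torus n) :=
  volume.withDensity fun x => ENNReal.ofReal (w x)

/-- The operator `S` maps `L^p_v` boundedly into `L^p_u`. -/
def MapsStrong {n : ℕ} (p : ℝ) (v u : Torus n → ℝ) (S : (Torus n → ℂ) → Torus n → ℝ≥0∞) : Prop :=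
  ∃ C : ℝ≥0, ∀ f, MemWeightedLp p v f →
    MemWeightedLp p u (S f) ∧ weightedNorm p u (S f) ≤ C * weightedNorm p v f

/-- The operator `S` maps `L^p_v` boundedly into weak `L^p_u`. -/
def MapsWeak {n : ℕ} (p : ℝ) (v u : Torus n → ℝ) (S : (Torus n → ℂ) → Torus n → ℝ≥0∞) : Prop :=
  ∃ C : ℝ≥0, ∀ f, MemWeightedLp p v f →
    AEStronglyMeasurable (S f) volume ∧
      ∀ l : ℝ≥0, (l : ℝ≥0∞) ^ p * weightMeasure u {x | (l : ℝ≥0∞) < S f x} ≤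
        (C * weightedNorm p v f) ^ p

/-- The class `D^T_p`: weights `v` such that `v^{-1/p} φ_{t₀}` is in `L^{p'}` for some `t₀ > 0`,
where `1/p + 1/p' = 1` (so `p' = ∞` when `p = 1`). -/
def ClassD {n : ℕ} (p : ℝ) (v : Torus n → ℝ) : Prop :=
  ∃ t₀ : ℝ, 0 < t₀ ∧
    MemLp (fun x => v x ^ (-(1 / p)) * heatKernel t₀ x)
      (ENNReal.conjExponent (ENNReal.ofReal p)) volume

end

end TorusHeat

namespace TorusHeat

/-! The torus is compact, so for each fixed `t > 0` the kernel `φ_t` lies between two positive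
constants. Hence the kernel can be dropped from `ClassD`, which only says `v^{-1/p} ∈ L^{p'}`
(`classD_iff`), and finiteness of `φ_t * |f|` at a single point already means `f ∈ L¹`
(`integrable_of_heatConvFinite`). Everything then turns on the inclusion `L^p_v ⊆ L¹`. Hölder
derives it from `ClassD`, and a gliding hump followed by the converse of Hölder gives the reverse
(`classD_of_forall_integrable`). Conditions 3 and 4 each provide, for every `f`, a point where some
convolution is finite, so each implies 1; condition 2 implies 4 because `u > 0` almost everywhere.

For the positive results the heat kernel is dominated by a weighted sum of normalised indicators of
dyadic cubes, taken from `2ⁿ` translated dyadic systems (`exists_heatKernel_le_dyadic`). The weak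
type `(1, 1)` bound follows, and with it almost everywhere convergence on `L¹`; this gives 3, and 2
for `p = 1` with `u = 1`.

For `p > 1` put `σ = v^{-1/(p-1)}`, which is integrable, and write `|f| = σ g`. On each cube `Q` the
average of `|f|` is the average of `σ` times the `σ`-average of `g`, so `H*_R f ≤ C ∑_τ M_τ σ ·
M_τ^σ g` (`exists_heatMaximal_le`). The dyadic operators `M_τ^σ` are bounded on `L^p(σ)` with a norm
independent of `σ`, and `∫ g^p σ = ∫ |f|^p v`. Therefore `u = σ / (∑_τ M_τ σ)^p` works; it is
positive because `M_τ σ < ∞` almost everywhere (`exists_mapsStrong`). -/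

/-! ### The heat kernel: product structure, total mass and pointwise bounds. -/

theorem hasSum_pi_prod_of_nonneg {ι : Type*} {n : ℕ} {f : Fin n → ι → ℝ} {a : Fin n → ℝ}
    (hf : ∀ i k, 0 ≤ f i k) (h : ∀ i, HasSum (f i) (a i)) :
    HasSum (fun k : Fin n → ι => ∏ i, f i (k i)) (∏ i, a i) := by
  induction n with
  | zero => simp [hasSum_unique]
  | succ n ih =>
    have h0 := ih (fun i => hf i.succ) (fun i => h i.succ)
    have hs := (h 0).summable.mul_of_nonneg h0.summable (hf 0)
      (fun k => Finset.prod_nonneg fun i _ => hf _ _)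
    have h1 := (h 0).mul h0 hs
    rw [← (Fin.consEquiv fun _ : Fin (n + 1) => ι).hasSum_iff]
    simp only [Function.comp_def, Fin.consEquiv_apply, Fin.prod_univ_succ, Fin.cons_zero,
      Fin.cons_succ]
    exact h1

/-- The heat kernel on the circle `ℝ / ℤ`. -/
noncomputable def circleKernel (t : ℝ) (s : UnitAddCircle) : ℝ :=
  (4 * Real.pi * t) ^ (-(1 : ℝ) / 2) * HurwitzZeta.evenKernel s (1 / (4 * Real.pi * t))

theorem hasSum_circleKernel {t : ℝ} (ht : 0 < t) (a : ℝ) :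
    HasSum (fun k : ℤ => (4 * Real.pi * t) ^ (-(1 : ℝ) / 2) * Real.exp (-(a + k) ^ 2 / (4 * t)))
      (circleKernel t a) := by
  have hpi := Real.pi_pos
  have h := (HurwitzZeta.hasSum_int_evenKernel a (t := 1 / (4 * Real.pi * t))
    (by positivity)).mul_left ((4 * Real.pi * t) ^ (-(1 : ℝ) / 2))
  refine h.congr_fun ?_
  intro k
  congr 2
  field_simp
  ring

theorem heatKernel_eq_prod {n : ℕ} {t : ℝ} (ht : 0 < t) (x : Torus n) :
    heatKernel t x = ∏ i, circleKernel t (x i) := by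
  have hpi := Real.pi_pos
  have hx : ∀ i, ((cubeRep x i : ℝ) : UnitAddCircle) = x i := fun i => AddCircle.coe_equivIco
  have h := hasSum_pi_prod_of_nonneg
    (f := fun (i : Fin n) (k : ℤ) => (4 * Real.pi * t) ^ (-(1 : ℝ) / 2) *
      Real.exp (-(cubeRep x i + k) ^ 2 / (4 * t)))
    (fun i k => by positivity) (fun i => hasSum_circleKernel ht (cubeRep x i))
  simp only [hx] at h
  rw [← h.tsum_eq, heatKernel, ← tsum_mul_left]
  refine tsum_congr fun k => ?_
  rw [Finset.prod_mul_distrib, ← Real.exp_sum, Finset.prod_const, Finset.card_univ,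
    Fintype.card_fin, ← Real.rpow_natCast, ← Real.rpow_mul (by positivity),
    ← Finset.sum_div, Finset.sum_neg_distrib]
  congr 2
  ring

/-- The functional equation turns the Gaussian sum into a cosine series, a value of `jacobiTheta₂`,
which is continuous in its first variable. -/
theorem continuous_circleKernel {t : ℝ} (ht : 0 < t) : Continuous (circleKernel t) := by
  have hpi := Real.pi_pos
  have h : Continuous fun s : UnitAddCircle => HurwitzZeta.cosKernel s (4 * Real.pi * t) := by
    refine (QuotientAddGroup.isQuotientMap_mk _).continuous_iff.2 ?_
    rw [continuous_iff_continuousAt]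
    intro a
    have h1 : ContinuousAt (fun a : ℝ => (HurwitzZeta.cosKernel (a : UnitAddCircle)
        (4 * Real.pi * t) : ℂ)) a := by
      simp only [HurwitzZeta.cosKernel_def]
      exact (continuousAt_jacobiTheta₂ a (τ := Complex.I * ((4 * Real.pi * t : ℝ) : ℂ))
        (by simp; positivity)).comp
        (f := fun u : ℝ => ((u : ℂ), Complex.I * ((4 * Real.pi * t : ℝ) : ℂ))) (by fun_prop)
    exact Complex.continuous_re.continuousAt.comp h1
  unfold circleKernel
  simp only [HurwitzZeta.evenKernel_functional_equation, one_div_one_div]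
  fun_prop

theorem circleKernel_pos {t : ℝ} (ht : 0 < t) (s : UnitAddCircle) : 0 < circleKernel t s := by
  have hpi := Real.pi_pos
  induction s using QuotientAddGroup.induction_on with
  | H a =>
    have h := hasSum_circleKernel ht a
    exact h.tsum_eq ▸ h.summable.tsum_pos (fun k => by positivity) 0 (by positivity)

/-- By the functional equation the kernel is an absolutely summable Fourier series. Integrating term
by term leaves only frequency zero, whose coefficient is one. -/
theorem integral_circleKernel {t : ℝ} (ht : 0 < t) : ∫ s, circleKernel t s = 1 := by
  have hpi := Real.pi_pos
  have h4 : 0 < 4 * Real.pi * t := by positivity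
  have hF : ∀ s : UnitAddCircle, HasSum (fun k : ℤ => fourier k s *
      ((Real.exp (-Real.pi * k ^ 2 * (4 * Real.pi * t)) : ℝ) : ℂ)) (circleKernel t s : ℂ) := by
    intro s
    have he : circleKernel t s = HurwitzZeta.cosKernel s (4 * Real.pi * t) := by
      rw [circleKernel, HurwitzZeta.evenKernel_functional_equation, one_div_one_div,
        one_div, one_div, Real.inv_rpow h4.le, inv_inv, ← mul_assoc, ← Real.rpow_add h4]
      norm_num
    rw [he]
    induction s using QuotientAddGroup.induction_on with
    | H a =>
      refine (HurwitzZeta.hasSum_int_cosKernel a h4).congr_fun ?_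
      intro k
      congr 1
      erw [fourier_coe_apply]
      congr 1
      push_cast
      ring
  have hsum : Summable fun k : ℤ => Real.exp (-Real.pi * k ^ 2 * (4 * Real.pi * t)) := by
    simpa using (HurwitzZeta.hasSum_int_evenKernel 0 h4).summable
  have key := hasSum_integral_of_summable_integral_norm (μ := (volume : Measure UnitAddCircle))
    (F := fun (k : ℤ) (s : UnitAddCircle) => fourier k s *
      ((Real.exp (-Real.pi * k ^ 2 * (4 * Real.pi * t)) : ℝ) : ℂ))
    (fun k => Continuous.integrable_of_hasCompactSupport (by fun_prop)
      (HasCompactSupport.of_compactSpace _)) ?_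
  · simp only [(hF _).tsum_eq] at key
    have hz : ∀ k : ℤ, k ≠ 0 → ∫ s : UnitAddCircle, (fourier k s *
        ((Real.exp (-Real.pi * k ^ 2 * (4 * Real.pi * t)) : ℝ) : ℂ)) = 0 := by
      intro k hk
      rw [integral_mul_const, integral_eq_zero_of_add_right_eq_neg
        (fourier_add_half_inv_index hk one_pos), zero_mul]
    have h0 := key.unique (hasSum_single 0 hz)
    rw [show ∫ s : UnitAddCircle, (circleKernel t s : ℂ) = ((∫ s, circleKernel t s : ℝ) : ℂ) from
      integral_ofReal] at h0
    rw [← Complex.ofReal_inj, h0]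
    simp [Measure.real]
  · refine hsum.congr fun k => ?_
    have : ∀ s : UnitAddCircle, ‖fourier k s‖ = 1 := fun s => Circle.norm_coe _
    simp only [norm_mul, this, one_mul, Complex.norm_real, Real.norm_eq_abs, Real.abs_exp]
    simp [Measure.real]

theorem exists_circleKernel_le : ∃ K : ℝ, 0 < K ∧ ∀ t : ℝ, 0 < t → t ≤ 1 → ∀ s : UnitAddCircle,
    circleKernel t s ≤ K * t ^ (-(1 : ℝ) / 2) * Real.exp (-‖s‖ ^ 2 / (8 * t)) := by
  have hpi := Real.pi_pos
  have hS : Summable fun k : ℤ => Real.exp (-(k : ℝ) ^ 2 / 32) := by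
    refine (HurwitzZeta.hasSum_int_evenKernel 0 (t := 1 / (32 * Real.pi))
      (by positivity)).summable.congr fun k => ?_
    congr 1
    field_simp
    ring
  refine ⟨(4 * Real.pi) ^ (-(1 : ℝ) / 2) * ∑' k : ℤ, Real.exp (-(k : ℝ) ^ 2 / 32),
    mul_pos (by positivity) (hS.tsum_pos (fun k => by positivity) 0 (by positivity)), ?_⟩
  intro t ht ht1 s
  obtain ⟨a, ha, rfl⟩ : ∃ a : ℝ, |a| ≤ 1 / 2 ∧ (a : UnitAddCircle) = s := by
    refine ⟨AddCircle.equivIco (1 : ℝ) (-1 / 2) s, ?_, AddCircle.coe_equivIco⟩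
    have := (AddCircle.equivIco (1 : ℝ) (-1 / 2) s).2
    rw [abs_le]
    constructor <;> linarith [this.1, this.2]
  have hn : ‖(a : UnitAddCircle)‖ = |a| :=
    (AddCircle.norm_coe_eq_abs_iff (1 : ℝ) one_ne_zero).2 (by simpa using ha)
  rw [hn, sq_abs]
  have hrhs := (hS.hasSum.mul_left ((4 * Real.pi * t) ^ (-(1 : ℝ) / 2))).mul_right
    (Real.exp (-a ^ 2 / (8 * t)))
  have := hasSum_le (fun k => ?_) (hasSum_circleKernel ht a) hrhs
  · rw [Real.mul_rpow (by positivity) ht.le] at this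
    linarith
  · rw [mul_assoc _ (Real.exp _) (Real.exp _), ← Real.exp_add]
    gcongr
    obtain ⟨ha1, ha2⟩ := abs_le.1 ha
    -- As `|a| ≤ 1/2`, both `|a|` and `|k| / 2` are at most `|a + k|`. Half of the exponent `(a +
    -- k)² / (4t)` pays for the decay in `a`, the other half for the summability in `k`.
    have hk : a ^ 2 ≤ (a + k) ^ 2 ∧ (k : ℝ) ^ 2 ≤ 4 * (a + k) ^ 2 := by
      rcases lt_trichotomy k 0 with h | h | h
      · have : (k : ℝ) ≤ -1 := by exact_mod_cast Int.le_sub_one_of_lt h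
        constructor <;> nlinarith
      · subst h
        simp only [Int.cast_zero, add_zero]
        constructor <;> nlinarith
      · have : (1 : ℝ) ≤ k := by exact_mod_cast h
        constructor <;> nlinarith
    have h1 : (k : ℝ) ^ 2 / 32 ≤ (k : ℝ) ^ 2 / (32 * t) := by
      gcongr
      linarith
    have h2 : (a + k) ^ 2 / (4 * t) - a ^ 2 / (8 * t) - (k : ℝ) ^ 2 / (32 * t) =
        (4 * ((a + k) ^ 2 - a ^ 2) + (4 * (a + k) ^ 2 - k ^ 2)) / (32 * t) := by
      field_simp
      ring
    have h3 : 0 ≤ (4 * ((a + k) ^ 2 - a ^ 2) + (4 * (a + k) ^ 2 - k ^ 2)) / (32 * t) := by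
      apply div_nonneg _ (by positivity)
      linarith [hk.1, hk.2]
    rw [neg_div, neg_div, neg_div]
    linarith

theorem continuous_heatKernel {n : ℕ} {t : ℝ} (ht : 0 < t) :
    Continuous (heatKernel t : Torus n → ℝ) := by
  simp only [funext (heatKernel_eq_prod (n := n) ht)]
  exact continuous_finsetProd _ fun i _ => (continuous_circleKernel ht).comp (continuous_apply i)

theorem heatKernel_pos {n : ℕ} {t : ℝ} (ht : 0 < t) (x : Torus n) : 0 < heatKernel t x := by
  rw [heatKernel_eq_prod ht]
  exact Finset.prod_pos fun i _ => circleKernel_pos ht _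

theorem integral_heatKernel {n : ℕ} {t : ℝ} (ht : 0 < t) : ∫ x : Torus n, heatKernel t x = 1 := by
  simp only [heatKernel_eq_prod ht]
  rw [integral_fintype_prod_volume_eq_prod (fun _ : Fin n => circleKernel t)]
  simp [integral_circleKernel ht]

theorem exists_heatKernel_bounds {n : ℕ} {t : ℝ} (ht : 0 < t) :
    ∃ c C : ℝ, 0 < c ∧ ∀ x : Torus n, c ≤ heatKernel t x ∧ heatKernel t x ≤ C := by
  obtain ⟨x₀, -, h₀⟩ := isCompact_univ.exists_isMinOn Set.univ_nonempty
    (continuous_heatKernel (n := n) ht).continuousOn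
  obtain ⟨x₁, -, h₁⟩ := isCompact_univ.exists_isMaxOn Set.univ_nonempty
    (continuous_heatKernel (n := n) ht).continuousOn
  exact ⟨_, _, heatKernel_pos ht x₀, fun x => ⟨h₀ (Set.mem_univ x), h₁ (Set.mem_univ x)⟩⟩

theorem exists_exp_le_inv_pow (m : ℕ) : ∃ C : ℝ, 0 < C ∧ ∀ u : ℝ, 0 ≤ u →
    Real.exp (-u ^ 2 / 8) ≤ C / (1 + u) ^ m := by
  -- `(1 + u)^m ≤ m! e^{1+u}`, and `1 + u - u²/8 ≤ 3` is `(u - 4)² ≥ 0`.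
  refine ⟨m.factorial * Real.exp 3, by positivity, fun u hu => ?_⟩
  rw [le_div_iff₀ (by positivity)]
  have h1 := Real.pow_div_factorial_le_exp (1 + u) (by positivity) m
  rw [div_le_iff₀ (by positivity)] at h1
  have h2 : Real.exp (-u ^ 2 / 8) * Real.exp (1 + u) ≤ Real.exp 3 := by
    rw [← Real.exp_add]
    gcongr
    nlinarith [sq_nonneg (u - 4)]
  calc _ ≤ Real.exp (-u ^ 2 / 8) * (Real.exp (1 + u) * m.factorial) := by gcongr
    _ ≤ _ := by nlinarith [Nat.cast_nonneg (α := ℝ) m.factorial]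

/-- The Gaussian decay is weakened to a Poisson type bound. One power more than the dimension is
enough: it leaves a factor `√t · 2ᵏ` at scale `2⁻ᵏ`, which is summable over the scales with `√t · 2ᵏ
≤ 1`. -/
theorem exists_heatKernel_le (n : ℕ) : ∃ C : ℝ, 0 < C ∧ ∀ t : ℝ, 0 < t → t ≤ 1 → ∀ x : Torus n,
    heatKernel t x ≤ C * √t / (√t + ‖x‖) ^ (n + 1) := by
  obtain ⟨K, hK, hle⟩ := exists_circleKernel_le
  obtain ⟨C, hC, hexp⟩ := exists_exp_le_inv_pow (n + 1)
  refine ⟨K ^ n * C, by positivity, fun t ht ht1 x => ?_⟩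
  have hst : 0 < √t := Real.sqrt_pos.2 ht
  have hpow : t ^ (-(1 : ℝ) / 2) = (√t)⁻¹ := by
    rw [neg_div, Real.rpow_neg ht.le, Real.sqrt_eq_rpow]
  have hsum : ‖x‖ ^ 2 ≤ ∑ i, ‖x i‖ ^ 2 := by
    have h0 : 0 ≤ ∑ i, ‖x i‖ ^ 2 := Finset.sum_nonneg fun i _ => by positivity
    rw [← Real.le_sqrt (norm_nonneg _) h0]
    refine (pi_norm_le_iff_of_nonneg (Real.sqrt_nonneg _)).2 fun i => ?_
    rw [Real.le_sqrt (norm_nonneg _) h0]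
    exact Finset.single_le_sum (f := fun i => ‖x i‖ ^ 2) (fun i _ => by positivity)
      (Finset.mem_univ i)
  rw [heatKernel_eq_prod ht]
  calc ∏ i, circleKernel t (x i)
      ≤ ∏ i, (K * (√t)⁻¹ * Real.exp (-‖x i‖ ^ 2 / (8 * t))) :=
        Finset.prod_le_prod (fun i _ => (circleKernel_pos ht _).le)
          fun i _ => hpow ▸ hle t ht ht1 (x i)
    _ = K ^ n * (√t)⁻¹ ^ n * Real.exp (-(∑ i, ‖x i‖ ^ 2) / (8 * t)) := by
        rw [Finset.prod_mul_distrib, ← Real.exp_sum, Finset.prod_const, Finset.card_univ,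
          Fintype.card_fin, ← Finset.sum_div, Finset.sum_neg_distrib, mul_pow]
    _ ≤ K ^ n * (√t)⁻¹ ^ n * Real.exp (-(‖x‖ / √t) ^ 2 / 8) := by
        refine mul_le_mul_of_nonneg_left (Real.exp_le_exp.2 ?_) (by positivity)
        rw [div_pow, Real.sq_sqrt ht.le, neg_div, neg_div, neg_le_neg_iff, div_div, mul_comm t]
        gcongr
    _ ≤ K ^ n * (√t)⁻¹ ^ n * (C / (1 + ‖x‖ / √t) ^ (n + 1)) := by
        gcongr
        exact hexp _ (by positivity)
    _ = _ := by
        have : 1 + ‖x‖ / √t = (√t + ‖x‖) / √t := by field_simp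
        rw [this, div_pow, inv_pow]
        field_simp
        ring

/-! ### Maximal functions of nested partitions, for an arbitrary measure. -/

section NestedPartition

variable {X ι : Type*}

/-- The cell of `x` in the partition of `X` into the fibres of `q k`. -/
def cell (q : ℕ → X → ι) (k : ℕ) (x : X) : Set X := {y | q k y = q k x}

/-- The average of `F` over the cell of `x`. -/
noncomputable def cellAverage [MeasurableSpace X] (μ : Measure X) (q : ℕ → X → ι) (F : X → ℝ≥0∞)
    (k : ℕ) (x : X) : ℝ≥0∞ :=
  (∫⁻ y in cell q k x, F y ∂μ) / μ (cell q k x)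

/-- The maximal function of a sequence of partitions. -/
noncomputable def cellMaximal [MeasurableSpace X] (μ : Measure X) (q : ℕ → X → ι) (F : X → ℝ≥0∞)
    (x : X) : ℝ≥0∞ :=
  ⨆ k, cellAverage μ q F k x

/-- Each partition refines the previous one. -/
def IsNested (q : ℕ → X → ι) : Prop := ∀ k x y, q (k + 1) x = q (k + 1) y → q k x = q k y

theorem cell_congr {q : ℕ → X → ι} {k : ℕ} {x y : X} (h : q k x = q k y) :
    cell q k x = cell q k y := by
  simp [cell, h]

theorem IsNested.of_le {q : ℕ → X → ι} (hn : IsNested q) {j k : ℕ} (hjk : j ≤ k) {x y : X}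
    (h : q k x = q k y) : q j x = q j y := by
  induction k, hjk using Nat.le_induction with
  | base => exact h
  | succ k _ ih => exact ih (hn k x y h)

theorem measurableSet_cell [MeasurableSpace X] [MeasurableSpace ι] [MeasurableSingletonClass ι]
    {q : ℕ → X → ι} (hq : ∀ k, Measurable (q k)) (k : ℕ) (x : X) : MeasurableSet (cell q k x) :=
  hq k (measurableSet_singleton _)

theorem cellMaximal_le_add [MeasurableSpace X] (μ : Measure X) {q : ℕ → X → ι} {F G : X → ℝ≥0∞}
    {c : ℝ≥0∞} (hFG : ∀ x, F x ≤ G x + c) (x : X) :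
    cellMaximal μ q F x ≤ cellMaximal μ q G x + c := by
  refine iSup_le fun k => ?_
  calc cellAverage μ q F k x ≤ (∫⁻ y in cell q k x, (G y + c) ∂μ) / μ (cell q k x) := by
        unfold cellAverage
        gcongr with y
        exact hFG y
    _ = cellAverage μ q G k x + c * μ (cell q k x) / μ (cell q k x) := by
        rw [lintegral_add_right _ measurable_const, setLIntegral_const, ENNReal.add_div,
          cellAverage]
    _ ≤ _ := by
        gcongr
        · exact le_iSup (fun k => cellAverage μ q G k x) k
        · rw [mul_div_assoc]
          exact mul_le_of_le_one_right zero_le ENNReal.div_self_le_one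

variable [MeasurableSpace X] [MeasurableSpace ι] [Countable ι] [MeasurableSingletonClass ι]

theorem measurable_cellAverage (μ : Measure X) {q : ℕ → X → ι} (hq : ∀ k, Measurable (q k))
    (F : X → ℝ≥0∞) (k : ℕ) : Measurable (cellAverage μ q F k) :=
  (Measurable.of_discrete (f := fun a => (∫⁻ y in {y | q k y = a}, F y ∂μ) /
    μ {y | q k y = a})).comp (hq k)

theorem measurable_cellMaximal (μ : Measure X) {q : ℕ → X → ι} (hq : ∀ k, Measurable (q k))
    (F : X → ℝ≥0∞) : Measurable (cellMaximal μ q F) :=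
  Measurable.iSup fun k => measurable_cellAverage μ hq F k

/-- Doob's stopping argument: split the level set according to the first generation whose average
exceeds `l`. By nestedness each nonempty piece is a full cell, on which the average beats `l`; no
doubling of `μ` is needed. -/
theorem mul_meas_cellMaximal_le (μ : Measure X) {q : ℕ → X → ι} (hq : ∀ k, Measurable (q k))
    (hn : IsNested q) (F : X → ℝ≥0∞) (l : ℝ≥0∞) :
    l * μ {x | l < cellMaximal μ q F x} ≤ ∫⁻ x in {x | l < cellMaximal μ q F x}, F x ∂μ := by
  set T : ℕ × ι → Set X := fun a =>
    {x | q a.1 x = a.2 ∧ l < cellAverage μ q F a.1 x ∧ ∀ j < a.1, cellAverage μ q F j x ≤ l} with hT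
  have hU : {x | l < cellMaximal μ q F x} = ⋃ a, T a := by
    ext x
    simp only [Set.mem_ofPred_eq, cellMaximal, lt_iSup_iff, Set.mem_iUnion, hT, Prod.exists]
    constructor
    · intro h
      classical
      exact ⟨Nat.find h, _, rfl, Nat.find_spec h, fun j hj => not_lt.1 (Nat.find_min h hj)⟩
    · rintro ⟨k, -, -, h, -⟩
      exact ⟨k, h⟩
  have hlow : ∀ k, MeasurableSet {x | ∀ j < k, cellAverage μ q F j x ≤ l} := fun k => by
    have h : {x | ∀ j < k, cellAverage μ q F j x ≤ l} =
        ⋂ j, ⋂ _ : j < k, {x | cellAverage μ q F j x ≤ l} := by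
      ext x
      simp
    rw [h]
    exact MeasurableSet.iInter fun j => MeasurableSet.iInter fun _ =>
      measurableSet_le (measurable_cellAverage μ hq F j) measurable_const
  have hTm : ∀ a, MeasurableSet (T a) := fun a =>
    (hq a.1 (measurableSet_singleton a.2)).inter
      ((measurableSet_lt measurable_const (measurable_cellAverage μ hq F _)).inter (hlow a.1))
  have hTd : Pairwise (Function.onFun Disjoint T) := by
    rintro ⟨k, a⟩ ⟨k', a'⟩ hne
    refine Set.disjoint_left.2 ?_
    rintro x ⟨h1, h2, h3⟩ ⟨h1', h2', h3'⟩
    have hk : k = k' := by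
      rcases lt_trichotomy k k' with h | h | h
      · exact absurd h2 (not_lt.2 (h3' _ h))
      · exact h
      · exact absurd h2' (not_lt.2 (h3 _ h))
    subst hk
    exact hne (by rw [← show q k x = a from h1, ← show q k x = a' from h1'])
  rw [hU, lintegral_iUnion hTm hTd]
  calc l * μ (⋃ a, T a) ≤ l * ∑' a, μ (T a) := by gcongr; exact measure_iUnion_le _
    _ = ∑' a, l * μ (T a) := ENNReal.tsum_mul_left.symm
    _ ≤ _ := ENNReal.tsum_le_tsum fun a => ?_
  rcases (T a).eq_empty_or_nonempty with h | ⟨x, hx⟩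
  · simp [h]
  · have hc : T a = cell q a.1 x := by
      obtain ⟨h1, h2, h3⟩ := hx
      ext y
      constructor
      · rintro ⟨h, -⟩
        exact h.trans h1.symm
      · intro hy
        have hA : ∀ j ≤ a.1, cellAverage μ q F j y = cellAverage μ q F j x := fun j hj => by
          rw [cellAverage, cellAverage, cell_congr (hn.of_le hj hy)]
        refine ⟨(show q a.1 y = _ from hy).trans h1, (hA _ le_rfl).symm ▸ h2, fun j hj => ?_⟩
        rw [hA j hj.le]
        exact h3 j hj
    rw [hc]
    exact ENNReal.mul_le_of_le_div hx.2.1.le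

theorem cellMaximal_lt_top (μ : Measure X) {q : ℕ → X → ι} (hq : ∀ k, Measurable (q k))
    (hn : IsNested q) {F : X → ℝ≥0∞} (hF : ∫⁻ x, F x ∂μ ≠ ∞) :
    ∀ᵐ x ∂μ, cellMaximal μ q F x < ∞ := by
  have h : ∀ m : ℕ, m * μ {x | ¬ cellMaximal μ q F x < ∞} ≤ ∫⁻ x, F x ∂μ := fun m =>
    calc m * μ {x | ¬ cellMaximal μ q F x < ∞} ≤ m * μ {x | (m : ℝ≥0∞) < cellMaximal μ q F x} := by
          gcongr with x
          intro hx
          rw [not_lt, top_le_iff] at hx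
          rw [hx]
          exact ENNReal.natCast_lt_top m
      _ ≤ _ := (mul_meas_cellMaximal_le μ hq hn F m).trans (setLIntegral_le_lintegral _ _)
  by_contra hne
  have h0 : μ {x | ¬ cellMaximal μ q F x < ∞} ≠ 0 := fun h => hne (ae_iff.2 h)
  obtain ⟨m, hm⟩ := ENNReal.exists_nat_mul_gt h0 hF
  exact absurd (h m) (not_le.2 hm)

/-- The part of `F` below height `t / 2` adds at most `t / 2` to the maximal function, so the weak
type bound need only be applied to the part above. -/
theorem meas_cellMaximal_le (μ : Measure X) {q : ℕ → X → ι} (hq : ∀ k, Measurable (q k))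
    (hn : IsNested q) {F : X → ℝ≥0∞} (hF : Measurable F) {t : ℝ} (ht : 0 < t) :
    μ {x | ENNReal.ofReal t < cellMaximal μ q F x} ≤
      ENNReal.ofReal (2 / t) * ∫⁻ x in {x | ENNReal.ofReal (t / 2) < F x}, F x ∂μ := by
  set S := {x | ENNReal.ofReal (t / 2) < F x} with hS
  have hSm : MeasurableSet S := measurableSet_lt measurable_const hF
  set G := S.indicator F with hG
  have hFG : ∀ x, F x ≤ G x + ENNReal.ofReal (t / 2) := by
    intro x
    by_cases hx : x ∈ S
    · simp [hG, hx]
    · simp only [hG, hx, Set.indicator_of_notMem, not_false_eq_true, zero_add]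
      exact not_lt.1 hx
  have hsub : {x | ENNReal.ofReal t < cellMaximal μ q F x} ⊆
      {x | ENNReal.ofReal (t / 2) < cellMaximal μ q G x} := by
    intro x hx
    have h1 := lt_of_lt_of_le hx (cellMaximal_le_add μ (q := q) hFG x)
    have h2 : ENNReal.ofReal t = ENNReal.ofReal (t / 2) + ENNReal.ofReal (t / 2) := by
      rw [← ENNReal.ofReal_add (by positivity) (by positivity), add_halves]
    exact lt_of_add_lt_add_right (h2 ▸ h1)
  have hw := (mul_meas_cellMaximal_le μ hq hn G (ENNReal.ofReal (t / 2))).trans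
    (setLIntegral_le_lintegral _ _)
  rw [hG, lintegral_indicator hSm] at hw
  calc _ ≤ μ {x | ENNReal.ofReal (t / 2) < cellMaximal μ q G x} := measure_mono hsub
    _ = ENNReal.ofReal (2 / t) * (ENNReal.ofReal (t / 2) *
        μ {x | ENNReal.ofReal (t / 2) < cellMaximal μ q G x}) := by
        rw [← mul_assoc, ← ENNReal.ofReal_mul (by positivity),
          show 2 / t * (t / 2) = 1 by field_simp]
        simp
    _ ≤ _ := by gcongr

theorem setLIntegral_rpow_Ioo {s b : ℝ} (hs : 0 < s) (hb : 0 ≤ b) :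
    ∫⁻ t in Set.Ioo 0 b, ENNReal.ofReal (t ^ (s - 1)) = ENNReal.ofReal (b ^ s / s) := by
  rw [setLIntegral_congr Ioo_ae_eq_Ioc]
  have hi : IntervalIntegrable (fun t : ℝ => t ^ (s - 1)) volume 0 b :=
    intervalIntegral.intervalIntegrable_rpow' (by linarith)
  rw [← ofReal_integral_eq_lintegral_ofReal, ← intervalIntegral.integral_of_le hb,
    integral_rpow (Or.inl (by linarith))]
  · simp [Real.zero_rpow hs.ne']
  · exact (intervalIntegrable_iff_integrableOn_Ioc_of_le hb).1 hi
  · exact (ae_restrict_mem measurableSet_Ioc).mono fun t ht => Real.rpow_nonneg ht.1.le _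

/-- Marcinkiewicz interpolation: integrate the truncated weak type bound over levels and exchange
the integrals. The constant is uniform in `μ`, as is needed to take `μ = σ dx`. -/
theorem exists_lintegral_cellMaximal_rpow_le {p : ℝ} (hp : 1 < p) : ∃ C : ℝ≥0,
    ∀ (μ : Measure X) [IsFiniteMeasure μ] {q : ℕ → X → ι}, (∀ k, Measurable (q k)) → IsNested q →
      ∀ {F : X → ℝ≥0∞}, Measurable F →
        ∫⁻ x, cellMaximal μ q F x ^ p ∂μ ≤ C * ∫⁻ x, F x ^ p ∂μ := by
  -- The `+ 1` keeps the constant visibly nonzero, so that the bound is trivial when the right-hand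
  -- integral is infinite.
  refine ⟨Real.toNNReal (p * (2 * (2 ^ (p - 1) / (p - 1)))) + 1, ?_⟩
  intro μ _ q hq hn F hF
  have hp0 : 0 < p := by linarith
  by_cases hfin : ∫⁻ x, F x ^ p ∂μ = ∞
  · rw [hfin, ENNReal.mul_top]
    · exact le_top
    · simp
  have hFtop : ∀ᵐ x ∂μ, F x < ∞ := by
    filter_upwards [ae_lt_top (hF.pow_const p) hfin] with x hx
    exact (ENNReal.rpow_lt_top_iff_of_pos hp0).1 hx
  have hF1 : ∫⁻ x, F x ∂μ ≠ ∞ := by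
    have hle : ∫⁻ x, F x ∂μ ≤ ∫⁻ x, (1 + F x ^ p) ∂μ := by
      refine lintegral_mono fun x => ?_
      rcases le_total (F x) 1 with h | h
      · exact h.trans le_self_add
      · exact (ENNReal.le_rpow_self_of_one_le h hp.le).trans le_add_self
    refine ne_top_of_le_ne_top ?_ hle
    rw [lintegral_add_left measurable_const]
    simpa using hfin
  have hM := measurable_cellMaximal μ hq F
  have hMtop := cellMaximal_lt_top μ hq hn hF1
  have h1 : ∫⁻ x, cellMaximal μ q F x ^ p ∂μ =
      ∫⁻ x, ENNReal.ofReal ((cellMaximal μ q F x).toReal ^ p) ∂μ := by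
    refine lintegral_congr_ae ?_
    filter_upwards [hMtop] with x hx
    rw [← ENNReal.ofReal_rpow_of_nonneg ENNReal.toReal_nonneg hp0.le, ENNReal.ofReal_toReal hx.ne]
  rw [h1, lintegral_rpow_eq_lintegral_meas_lt_mul μ
    (Eventually.of_forall fun x => ENNReal.toReal_nonneg) hM.ennreal_toReal.aemeasurable hp0]
  have h2 : ∀ t ∈ Set.Ioi (0 : ℝ), μ {x | t < (cellMaximal μ q F x).toReal} *
      ENNReal.ofReal (t ^ (p - 1)) ≤ ∫⁻ x, {x : X | ENNReal.ofReal (t / 2) < F x}.indicator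
        (fun x => 2 * (ENNReal.ofReal (t ^ (p - 1 - 1)) * F x)) x ∂μ := by
    intro t ht
    have ht0 : 0 < t := ht
    have hSm : MeasurableSet {x | ENNReal.ofReal (t / 2) < F x} :=
      measurableSet_lt measurable_const hF
    rw [lintegral_indicator hSm, lintegral_const_mul _ (by fun_prop),
      lintegral_const_mul _ (by fun_prop)]
    calc _ ≤ μ {x | ENNReal.ofReal t < cellMaximal μ q F x} * ENNReal.ofReal (t ^ (p - 1)) := by
          gcongr with x
          intro hx
          exact (ENNReal.ofReal_lt_iff_lt_toReal ht0.le (by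
            rintro h
            simp [h] at hx
            linarith)).2 hx
      _ ≤ (ENNReal.ofReal (2 / t) * ∫⁻ x in {x | ENNReal.ofReal (t / 2) < F x}, F x ∂μ) *
          ENNReal.ofReal (t ^ (p - 1)) := by
          gcongr
          exact meas_cellMaximal_le μ hq hn hF ht0
      _ = _ := by
          have : ENNReal.ofReal (2 / t) * ENNReal.ofReal (t ^ (p - 1)) =
              2 * ENNReal.ofReal (t ^ (p - 1 - 1)) := by
            rw [← ENNReal.ofReal_mul (by positivity), Real.rpow_sub_one ht0.ne' (p - 1),
              show (2 : ℝ≥0∞) = ENNReal.ofReal 2 by simp, ← ENNReal.ofReal_mul (by positivity)]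
            congr 1
            field_simp
          rw [mul_right_comm, this, mul_assoc]
  have h3 : ∀ᵐ x ∂μ, ∫⁻ t in Set.Ioi (0 : ℝ), {x : X | ENNReal.ofReal (t / 2) < F x}.indicator
      (fun x => 2 * (ENNReal.ofReal (t ^ (p - 1 - 1)) * F x)) x =
      ENNReal.ofReal (2 * (2 ^ (p - 1) / (p - 1))) * F x ^ p := by
    filter_upwards [hFtop] with x hx
    obtain ⟨f, hf⟩ : ∃ f : ℝ≥0, F x = f := ⟨(F x).toNNReal, (ENNReal.coe_toNNReal hx.ne).symm⟩
    have hset : ∀ t ∈ Set.Ioi (0 : ℝ), {x : X | ENNReal.ofReal (t / 2) < F x}.indicator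
        (fun x => 2 * (ENNReal.ofReal (t ^ (p - 1 - 1)) * F x)) x = (Set.Iio (2 * f : ℝ)).indicator
        (fun t => 2 * F x * ENNReal.ofReal (t ^ (p - 1 - 1))) t := by
      intro t ht
      have ht0 : 0 < t := ht
      have hiff : x ∈ {x : X | ENNReal.ofReal (t / 2) < F x} ↔ t ∈ Set.Iio (2 * f : ℝ) := by
        rw [Set.mem_ofPred_eq, hf, ENNReal.ofReal_lt_coe_iff (by positivity), Set.mem_Iio,
          div_lt_iff₀' two_pos]
      by_cases h : t ∈ Set.Iio (2 * f : ℝ)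
      · rw [Set.indicator_of_mem (hiff.2 h), Set.indicator_of_mem h]
        ring
      · rw [Set.indicator_of_notMem (fun h' => h (hiff.1 h')), Set.indicator_of_notMem h]
    rw [setLIntegral_congr_fun measurableSet_Ioi hset, lintegral_indicator measurableSet_Iio,
      Measure.restrict_restrict measurableSet_Iio, Set.inter_comm, Set.Ioi_inter_Iio,
      lintegral_const_mul _ (by fun_prop), setLIntegral_rpow_Ioo (by linarith) (by positivity), hf]
    have hfp : (f : ℝ≥0∞) = ENNReal.ofReal f := by simp
    rw [hfp, ENNReal.ofReal_rpow_of_nonneg f.coe_nonneg hp0.le,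
      show (2 : ℝ≥0∞) = ENNReal.ofReal 2 by simp, ← ENNReal.ofReal_mul (by positivity),
      ← ENNReal.ofReal_mul (by positivity), ← ENNReal.ofReal_mul (by
        have : 0 < p - 1 := by linarith
        positivity), Real.mul_rpow (by positivity) f.coe_nonneg]
    congr 1
    have : (f : ℝ) ^ p = f * f ^ (p - 1) := by
      rcases f.coe_nonneg.eq_or_lt with h | h
      · have h' : (f : ℝ) = 0 := h.symm
        rw [h', Real.zero_rpow hp0.ne', zero_mul]
      · have h' : (0 : ℝ) < f := h
        rw [Real.rpow_sub_one h'.ne']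
        field_simp
    rw [this]
    ring
  calc _ ≤ ENNReal.ofReal p * ∫⁻ t in Set.Ioi (0 : ℝ), ∫⁻ x,
        {x : X | ENNReal.ofReal (t / 2) < F x}.indicator
        (fun x => 2 * (ENNReal.ofReal (t ^ (p - 1 - 1)) * F x)) x ∂μ := by
        gcongr 1
        exact setLIntegral_mono' measurableSet_Ioi h2
    _ = ENNReal.ofReal p * ∫⁻ x, (∫⁻ t in Set.Ioi (0 : ℝ),
        {x : X | ENNReal.ofReal (t / 2) < F x}.indicator
        (fun x => 2 * (ENNReal.ofReal (t ^ (p - 1 - 1)) * F x)) x) ∂μ := by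
        congr 1
        refine lintegral_lintegral_swap (Measurable.aemeasurable ?_)
        have hms : MeasurableSet {z : ℝ × X | ENNReal.ofReal (z.1 / 2) < F z.2} :=
          measurableSet_lt (by fun_prop) (by fun_prop)
        exact Measurable.indicator (f := fun z : ℝ × X =>
          2 * (ENNReal.ofReal (z.1 ^ (p - 1 - 1)) * F z.2)) (by fun_prop) hms
    _ = ENNReal.ofReal (p * (2 * (2 ^ (p - 1) / (p - 1)))) * ∫⁻ x, F x ^ p ∂μ := by
        rw [lintegral_congr_ae h3, lintegral_const_mul _ (hF.pow_const p), ← mul_assoc,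
          ← ENNReal.ofReal_mul hp0.le]
    _ ≤ _ := by
        gcongr
        push_cast
        exact le_self_add

end NestedPartition

/-! ### Translated dyadic systems on the torus. -/

/-- The index of the dyadic interval of length `2⁻ᵏ` containing a point of the circle. -/
noncomputable def circleIndex (k : ℕ) (s : UnitAddCircle) : ℤ :=
  ⌊((2 ^ k : ℕ) : ℝ) * (AddCircle.equivIco (1 : ℝ) 0 s : ℝ)⌋

theorem measurable_circleIndex (k : ℕ) : Measurable (circleIndex k) :=
  Int.measurable_floor.comp (measurable_const.mul
    (measurable_subtype_coe.comp (AddCircle.measurableEquivIco (1 : ℝ) 0).measurable))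

theorem circleIndex_zero (s : UnitAddCircle) : circleIndex 0 s = 0 := by
  have h := (AddCircle.equivIco (1 : ℝ) 0 s).2
  simp only [zero_add, Set.mem_Ico] at h
  rw [circleIndex, Int.floor_eq_iff]
  simpa using h

theorem circleIndex_of_succ_eq {k : ℕ} {s s' : UnitAddCircle}
    (h : circleIndex (k + 1) s = circleIndex (k + 1) s') : circleIndex k s = circleIndex k s' := by
  have key : ∀ s, circleIndex k s = circleIndex (k + 1) s / 2 := fun s => by
    unfold circleIndex
    rw [← Int.natCast_mul_floor_div_cancel two_ne_zero, ← mul_assoc, ← Nat.cast_mul, pow_succ,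
      mul_comm 2]
    rfl
  rw [key, key, h]

theorem circleIndex_coe (k : ℕ) (a : ℝ) :
    circleIndex k a = ⌊((2 ^ k : ℕ) : ℝ) * a⌋ - (2 ^ k : ℕ) * (⌊((2 ^ k : ℕ) : ℝ) * a⌋ / (2 ^ k : ℕ)) := by
  rw [Int.natCast_mul_floor_div_cancel (by positivity), circleIndex,
    AddCircle.coe_equivIco_mk_apply, div_one, mul_one, Int.fract, mul_sub]
  exact_mod_cast Int.floor_sub_intCast (((2 ^ k : ℕ) : ℝ) * a) ((2 ^ k : ℕ) * ⌊a⌋)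

theorem exists_lift_norm_eq (s : UnitAddCircle) : ∃ d : ℝ, (d : UnitAddCircle) = s ∧ |d| = ‖s‖ := by
  induction s using QuotientAddGroup.induction_on with
  | H a =>
    refine ⟨a - round a, ?_, UnitAddCircle.norm_eq.symm⟩
    have : ((a - round a : ℝ) : UnitAddCircle) = (a : UnitAddCircle) - ((round a : ℝ) : UnitAddCircle) :=
      AddCircle.coe_sub _ _ _
    have h0 : ((round a : ℝ) : UnitAddCircle) = 0 :=
      (AddCircle.coe_eq_zero_iff (1 : ℝ)).2 ⟨round a, by simp⟩
    rw [this, h0]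
    exact sub_zero _

/-- The one-third trick: two close points lie in a common dyadic interval, either of the standard
system or of its translate by one third. -/
theorem circleIndex_eq_or {k : ℕ} {s s' : UnitAddCircle} (h : 3 * 2 ^ k * ‖s - s'‖ < 1) :
    circleIndex k s = circleIndex k s' ∨
      circleIndex k (s + ((1 / 3 : ℝ) : UnitAddCircle)) =
        circleIndex k (s' + ((1 / 3 : ℝ) : UnitAddCircle)) := by
  obtain ⟨d, hd, hdn⟩ := exists_lift_norm_eq (s - s')
  obtain ⟨b, rfl⟩ := QuotientAddGroup.mk_surjective s'
  have hs : s = ((b + d : ℝ) : UnitAddCircle) := by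
    rw [AddCircle.coe_add, hd]
    exact (add_sub_cancel _ _).symm
  subst hs
  change circleIndex k ((b + d : ℝ) : UnitAddCircle) = circleIndex k (b : UnitAddCircle) ∨
    circleIndex k (((b + d : ℝ) : UnitAddCircle) + ((1 / 3 : ℝ) : UnitAddCircle)) =
      circleIndex k ((b : UnitAddCircle) + ((1 / 3 : ℝ) : UnitAddCircle))
  rw [← AddCircle.coe_add, ← AddCircle.coe_add, circleIndex_coe, circleIndex_coe, circleIndex_coe,
    circleIndex_coe]
  rw [← hdn] at h
  set N : ℕ := 2 ^ k with hN
  have hNr : (N : ℝ) = 2 ^ k := by simp [hN]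
  rw [← hNr] at h
  suffices H : ⌊(N : ℝ) * (b + d)⌋ = ⌊(N : ℝ) * b⌋ ∨
      ⌊(N : ℝ) * (b + d + 1 / 3)⌋ = ⌊(N : ℝ) * (b + 1 / 3)⌋ by
    rcases H with H | H
    · left; rw [H]
    · right; rw [H]
  have hN0 : (0 : ℝ) < N := by rw [hNr]; positivity
  have hd3 : |3 * ((N : ℝ) * d)| < 1 := by
    rw [abs_mul, abs_mul, abs_of_pos hN0, abs_of_pos (by norm_num : (0 : ℝ) < 3)]
    linarith
  obtain ⟨hd1, hd2⟩ := abs_lt.1 hd3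
  -- a change of integer part puts an integer between the two numbers
  have hsep : ∀ u v : ℝ, ⌊u⌋ ≠ ⌊v⌋ → ∃ m : ℤ, (u < m ∧ (m : ℝ) ≤ v) ∨ (v < m ∧ (m : ℝ) ≤ u) := by
    intro u v huv
    rcases lt_or_gt_of_ne huv with h | h
    · exact ⟨⌊v⌋, Or.inl ⟨Int.floor_lt.1 h, Int.floor_le v⟩⟩
    · exact ⟨⌊u⌋, Or.inr ⟨Int.floor_lt.1 h, Int.floor_le u⟩⟩
  by_contra hcon
  rw [not_or] at hcon
  obtain ⟨m, hm⟩ := hsep _ _ hcon.1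
  obtain ⟨m', hm'⟩ := hsep _ _ hcon.2
  -- If both systems separate the points, `m` and `m' - N/3` lie between `N b` and `N (b + d)`, less
  -- than `1/3` apart. Then the integer `3 (m' - m) - N` must vanish, which is absurd since `N = 2ᵏ`
  -- is not divisible by three.
  have hlt : |((3 * (m' - m) - N : ℤ) : ℝ)| < 1 := by
    push_cast
    rw [abs_lt]
    rcases hm with ⟨h1, h2⟩ | ⟨h1, h2⟩ <;> rcases hm' with ⟨h3, h4⟩ | ⟨h3, h4⟩ <;>
      constructor <;> nlinarith
  have hz : 3 * (m' - m) - (N : ℤ) = 0 := by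
    rw [← Int.abs_lt_one_iff]
    exact_mod_cast hlt
  have hdvd : 3 ∣ 2 ^ k := by
    have : (3 : ℤ) ∣ (N : ℤ) := ⟨m' - m, by linarith⟩
    exact_mod_cast this
  exact absurd (Nat.prime_three.dvd_of_dvd_pow hdvd) (by norm_num)

theorem norm_sub_le_of_circleIndex_eq {k : ℕ} {s s' : UnitAddCircle}
    (h : circleIndex k s = circleIndex k s') : ‖s - s'‖ ≤ (1 / 2) ^ k := by
  have h1 := Int.abs_sub_lt_one_of_floor_eq_floor h
  rw [← mul_sub, abs_mul, abs_of_pos (by positivity)] at h1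
  set a : ℝ := (AddCircle.equivIco (1 : ℝ) 0 s : ℝ) with ha
  set b : ℝ := (AddCircle.equivIco (1 : ℝ) 0 s' : ℝ) with hb
  have hs : s - s' = ((a - b : ℝ) : UnitAddCircle) := by
    rw [AddCircle.coe_sub, ha, hb, AddCircle.coe_equivIco, AddCircle.coe_equivIco]
  rw [hs, UnitAddCircle.norm_eq, one_div, inv_pow, ← one_div, le_div_iff₀' (by positivity)]
  have h2 := round_le (a - b) 0
  rw [Int.cast_zero, sub_zero] at h2
  push_cast at h1
  exact (mul_le_mul_of_nonneg_left h2 (by positivity)).trans h1.le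

/-- The index of the dyadic cube of side `2⁻ᵏ` containing a point of the torus, in the dyadic
system translated by one third in the directions `i` with `τ i`. -/
noncomputable def torusIndex {n : ℕ} (τ : Fin n → Bool) (k : ℕ) (x : Torus n) (i : Fin n) : ℤ :=
  circleIndex k (x i + if τ i then ((1 / 3 : ℝ) : UnitAddCircle) else 0)

theorem measurable_torusIndex {n : ℕ} (τ : Fin n → Bool) (k : ℕ) : Measurable (torusIndex τ k) :=
  measurable_pi_lambda _ fun i =>
    (measurable_circleIndex k).comp ((measurable_pi_apply i).add_const _)

theorem isNested_torusIndex {n : ℕ} (τ : Fin n → Bool) : IsNested (torusIndex τ) :=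
  fun _ _ _ h => funext fun i => circleIndex_of_succ_eq (congrFun h i)

theorem exists_mem_cell {n k : ℕ} {x y : Torus n} (h : k = 0 ∨ 3 * 2 ^ k * ‖x - y‖ < 1) :
    ∃ τ : Fin n → Bool, y ∈ cell (torusIndex τ) k x := by
  classical
  rcases h with rfl | h
  · exact ⟨fun _ => false, funext fun i => by simp [torusIndex, circleIndex_zero]⟩
  · refine ⟨fun i => if circleIndex k (y i) = circleIndex k (x i) then false else true,
      funext fun i => ?_⟩
    have hi : 3 * 2 ^ k * ‖y i - x i‖ < 1 := by
      refine lt_of_le_of_lt ?_ h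
      rw [norm_sub_rev]
      gcongr
      exact norm_le_pi_norm (x - y) i
    by_cases hxy : circleIndex k (y i) = circleIndex k (x i)
    · simp [torusIndex, hxy]
    · simpa [torusIndex, hxy] using (circleIndex_eq_or hi).resolve_left hxy

theorem pow_mul_volume_cell_le {n : ℕ} (τ : Fin n → Bool) (k : ℕ) (x : Torus n) :
    (2 ^ k) ^ n * volume (cell (torusIndex τ) k x) ≤ 2 ^ n := by
  have hsub : cell (torusIndex τ) k x ⊆ Metric.closedBall x ((1 / 2) ^ k) := by
    intro y hy
    rw [Metric.mem_closedBall, dist_eq_norm]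
    refine (pi_norm_le_iff_of_nonneg (by positivity)).2 fun i => ?_
    simpa using norm_sub_le_of_circleIndex_eq (congrFun hy i)
  calc (2 ^ k) ^ n * volume (cell (torusIndex τ) k x)
      ≤ (2 ^ k) ^ n * volume (Metric.closedBall x ((1 / 2) ^ k)) := by gcongr
    _ ≤ (2 ^ k) ^ n * ENNReal.ofReal (2 * (1 / 2) ^ k) ^ n := by
        gcongr
        rw [volume_pi_closedBall _ (by positivity)]
        calc _ ≤ ∏ _i : Fin n, ENNReal.ofReal (2 * (1 / 2) ^ k) :=
              Finset.prod_le_prod' fun i _ => by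
                rw [AddCircle.volume_closedBall]
                exact ENNReal.ofReal_le_ofReal (min_le_right _ _)
          _ = _ := by simp
    _ = 2 ^ n := by
        rw [← mul_pow]
        congr 1
        rw [show (2 : ℝ≥0∞) ^ k = ENNReal.ofReal (2 ^ k) by simp, ← ENNReal.ofReal_mul (by positivity),
          mul_left_comm, ← mul_pow]
        simp

/-! ### Dyadic domination of the heat kernel. -/

/-- The weight of the scale `2⁻ᵏ` in the dyadic majorant of the heat kernel. -/
noncomputable def scaleWeight (t : ℝ) (k : ℕ) : ℝ≥0∞ :=
  if √t * 2 ^ k ≤ 1 then ENNReal.ofReal (√t * 2 ^ k) else 0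

theorem tsum_scaleWeight_le {t : ℝ} (ht : 0 < t) (ht1 : t ≤ 1) : ∑' k, scaleWeight t k ≤ 2 := by
  have hst : 0 < √t := Real.sqrt_pos.2 ht
  have hst1 : √t ≤ 1 := Real.sqrt_le_one.2 ht1
  obtain ⟨N, hN1, hN2⟩ := exists_nat_pow_near (x := 1 / √t) (y := 2)
    ((one_le_div hst).2 hst1) one_lt_two
  rw [tsum_eq_sum (s := Finset.range (N + 1))]
  · calc _ ≤ ∑ k ∈ Finset.range (N + 1), ENNReal.ofReal (√t * 2 ^ k) :=
          Finset.sum_le_sum fun k _ => by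
            unfold scaleWeight
            split_ifs <;> simp
      _ = ENNReal.ofReal (√t * ∑ k ∈ Finset.range (N + 1), 2 ^ k) := by
          rw [Finset.mul_sum, ENNReal.ofReal_sum_of_nonneg fun k _ => by positivity]
      _ ≤ ENNReal.ofReal 2 := by
          refine ENNReal.ofReal_le_ofReal ?_
          rw [geom_sum_eq (by norm_num), pow_succ]
          rw [le_div_iff₀' hst] at hN1
          nlinarith
      _ = 2 := by simp
  · intro k hk
    rw [Finset.mem_range, not_lt] at hk
    rw [scaleWeight, if_neg]
    rw [not_le]
    rw [div_lt_iff₀' hst] at hN2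
    refine hN2.trans_le ?_
    gcongr
    norm_num

theorem exists_heatKernel_le_dyadic (n : ℕ) : ∃ C : ℝ≥0, ∀ t : ℝ, 0 < t → t ≤ 1 →
    ∀ x y : Torus n, ENNReal.ofReal (heatKernel t (x - y)) ≤
      C * ∑' k, scaleWeight t k * ∑ τ : Fin n → Bool,
        (2 ^ k) ^ n * (cell (torusIndex τ) k x).indicator 1 y := by
  obtain ⟨C, hC, hle⟩ := exists_heatKernel_le n
  refine ⟨(C * 6 ^ (n + 1)).toNNReal, fun t ht ht1 x y => ?_⟩
  have hst : 0 < √t := Real.sqrt_pos.2 ht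
  have hst1 : √t ≤ 1 := Real.sqrt_le_one.2 ht1
  set r := √t + ‖x - y‖ with hr
  have hr0 : 0 < r := by positivity
  have htr : √t ≤ r := le_add_of_nonneg_right (norm_nonneg _)
  have hdr : ‖x - y‖ < r := lt_add_of_pos_left _ hst
  -- The scale is `2ᵏ ≤ 1 / (3r) < 2ᵏ⁺¹`: fine enough that `r^{-(n+1)}` is comparable to
  -- `2^{k(n+1)}`, coarse enough for the one-third trick. When `3r > 1` the whole torus, `k = 0`,
  -- serves.
  obtain ⟨k, hk1, hk2, hk3⟩ : ∃ k : ℕ, (k = 0 ∨ 3 * 2 ^ k * ‖x - y‖ < 1) ∧ 1 / r ≤ 6 * 2 ^ k ∧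
      √t * 2 ^ k ≤ 1 := by
    rcases le_or_gt (3 * r) 1 with h | h
    · obtain ⟨k, h1, h2⟩ := exists_nat_pow_near (x := 1 / (3 * r)) (y := 2)
        ((one_le_div (by positivity)).2 h) one_lt_two
      rw [le_div_iff₀ (by positivity)] at h1
      rw [div_lt_iff₀ (by positivity), pow_succ] at h2
      refine ⟨k, Or.inr ?_, ?_, ?_⟩
      · have : (0 : ℝ) < 2 ^ k := by positivity
        nlinarith
      · rw [div_le_iff₀ hr0]
        nlinarith
      · have : (0 : ℝ) < 2 ^ k := by positivity
        nlinarith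
    · refine ⟨0, Or.inl rfl, ?_, by simpa using hst1⟩
      rw [div_le_iff₀ hr0]
      linarith
  obtain ⟨τ, hτ⟩ := exists_mem_cell hk1
  calc ENNReal.ofReal (heatKernel t (x - y))
      ≤ ENNReal.ofReal (C * 6 ^ (n + 1) * ((√t * 2 ^ k) * (2 ^ k) ^ n)) := by
        refine ENNReal.ofReal_le_ofReal ((hle t ht ht1 _).trans ?_)
        calc C * √t / r ^ (n + 1) = C * √t * (1 / r) ^ (n + 1) := by
              rw [one_div, inv_pow, div_eq_mul_inv]
          _ ≤ C * √t * (6 * 2 ^ k) ^ (n + 1) := by gcongr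
          _ = _ := by rw [mul_pow, pow_succ (2 ^ k : ℝ) n]; ring
    _ = (C * 6 ^ (n + 1)).toNNReal * (scaleWeight t k * (2 ^ k) ^ n) := by
        rw [ENNReal.ofReal_mul (by positivity), ENNReal.ofReal_mul (p := √t * 2 ^ k) (by positivity),
          scaleWeight, if_pos hk3]
        congr 2
        rw [ENNReal.ofReal_pow (by positivity), ENNReal.ofReal_pow (by positivity)]
        simp
    _ ≤ (C * 6 ^ (n + 1)).toNNReal * (scaleWeight t k * ∑ τ : Fin n → Bool,
          (2 ^ k) ^ n * (cell (torusIndex τ) k x).indicator 1 y) := by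
        gcongr
        calc ((2 : ℝ≥0∞) ^ k) ^ n = (2 ^ k) ^ n * (cell (torusIndex τ) k x).indicator 1 y := by
              simp [Set.indicator_of_mem hτ]
          _ ≤ _ := Finset.single_le_sum (f := fun τ : Fin n → Bool =>
              ((2 : ℝ≥0∞) ^ k) ^ n * (cell (torusIndex τ) k x).indicator 1 y)
              (fun _ _ => zero_le) (Finset.mem_univ τ)
    _ ≤ _ := by
        gcongr
        exact ENNReal.le_tsum (f := fun k => scaleWeight t k * ∑ τ : Fin n → Bool,
          (2 ^ k) ^ n * (cell (torusIndex τ) k x).indicator 1 y) k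

/-- Factorisation of the heat semigroup through dyadic maximal functions: `φ_t * (σ g)` is
controlled by the maximal function of `σ` times the maximal function of `g` relative to `σ dx`. -/
theorem exists_lintegral_heatKernel_mul_le (n : ℕ) : ∃ C : ℝ≥0, ∀ {σ g : Torus n → ℝ≥0∞},
    Measurable σ → Measurable g → ∫⁻ x, σ x ≠ ∞ → ∀ t : ℝ, 0 < t → t ≤ 1 → ∀ x : Torus n,
      ∫⁻ y, ENNReal.ofReal (heatKernel t (x - y)) * (σ y * g y) ≤
        C * ∑ τ : Fin n → Bool, cellMaximal volume (torusIndex τ) σ x *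
          cellMaximal (volume.withDensity σ) (torusIndex τ) g x := by
  obtain ⟨C, hC⟩ := exists_heatKernel_le_dyadic n
  refine ⟨C * 2 * 2 ^ n, fun {σ g} hσ hg hσ1 t ht ht1 x => ?_⟩
  have hcell : ∀ (τ : Fin n → Bool) (k : ℕ), MeasurableSet (cell (torusIndex τ) k x) := fun τ k =>
    measurableSet_cell (measurable_torusIndex τ) k x
  -- For a cube `Q`, `2^{kn} ∫_Q σ g` is at most `2ⁿ` times `σ(Q) / |Q|` times the `σ`-average of
  -- `g` over `Q`; each average is bounded by its maximal function.
  have hterm : ∀ (τ : Fin n → Bool) (k : ℕ),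
      (2 ^ k) ^ n * ∫⁻ y in cell (torusIndex τ) k x, σ y * g y ≤
        2 ^ n * (cellMaximal volume (torusIndex τ) σ x *
          cellMaximal (volume.withDensity σ) (torusIndex τ) g x) := by
    intro τ k
    set Q := cell (torusIndex τ) k x with hQ
    have hμQ : volume.withDensity σ Q = ∫⁻ y in Q, σ y := withDensity_apply _ (hcell τ k)
    have hI : ∫⁻ y in Q, σ y * g y = ∫⁻ y in Q, g y ∂(volume.withDensity σ) :=
      (setLIntegral_withDensity_eq_setLIntegral_mul volume hσ hg (hcell τ k)).symm
    have h1 : ((2 : ℝ≥0∞) ^ k) ^ n * volume.withDensity σ Q ≤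
        2 ^ n * cellMaximal volume (torusIndex τ) σ x := by
      calc ((2 : ℝ≥0∞) ^ k) ^ n * volume.withDensity σ Q
          ≤ 2 ^ n / volume Q * volume.withDensity σ Q := by
            gcongr
            rw [ENNReal.le_div_iff_mul_le (Or.inr (by simp)) (Or.inr (by simp))]
            exact pow_mul_volume_cell_le τ k x
        _ = 2 ^ n * cellAverage volume (torusIndex τ) σ k x := by
            rw [hμQ, cellAverage, ← hQ, div_eq_mul_inv, div_eq_mul_inv]
            ring
        _ ≤ _ := by
            gcongr
            exact le_iSup (fun k => cellAverage volume (torusIndex τ) σ k x) k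
    have h2 : ∫⁻ y in Q, σ y * g y ≤ volume.withDensity σ Q *
        cellMaximal (volume.withDensity σ) (torusIndex τ) g x := by
      rw [hI]
      rcases eq_or_ne (volume.withDensity σ Q) 0 with h0 | h0
      · rw [setLIntegral_measure_zero _ _ h0]
        exact zero_le
      · have htop : volume.withDensity σ Q ≠ ∞ := by
          rw [hμQ]
          exact ne_top_of_le_ne_top hσ1 (setLIntegral_le_lintegral _ _)
        calc _ = volume.withDensity σ Q *
              cellAverage (volume.withDensity σ) (torusIndex τ) g k x := by
              rw [cellAverage, ← hQ, ENNReal.mul_div_cancel h0 htop]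
          _ ≤ _ := by
              gcongr
              exact le_iSup (fun k => cellAverage (volume.withDensity σ) (torusIndex τ) g k x) k
    calc _ ≤ ((2 : ℝ≥0∞) ^ k) ^ n * (volume.withDensity σ Q *
          cellMaximal (volume.withDensity σ) (torusIndex τ) g x) := by gcongr
      _ = (((2 : ℝ≥0∞) ^ k) ^ n * volume.withDensity σ Q) *
          cellMaximal (volume.withDensity σ) (torusIndex τ) g x := by rw [mul_assoc]
      _ ≤ _ := by
          rw [← mul_assoc]
          gcongr
  have hmeas : ∀ (τ : Fin n → Bool) (k : ℕ), Measurable fun y =>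
      (2 ^ k) ^ n * (cell (torusIndex τ) k x).indicator 1 y * (σ y * g y) := fun τ k =>
    (measurable_const.mul (measurable_one.indicator (hcell τ k))).mul (hσ.mul hg)
  calc ∫⁻ y, ENNReal.ofReal (heatKernel t (x - y)) * (σ y * g y)
      ≤ ∫⁻ y, C * ∑' k, scaleWeight t k * ∑ τ : Fin n → Bool,
          (2 ^ k) ^ n * (cell (torusIndex τ) k x).indicator 1 y * (σ y * g y) := by
        refine lintegral_mono fun y => ?_
        calc _ ≤ (C * ∑' k, scaleWeight t k * ∑ τ : Fin n → Bool,
              (2 ^ k) ^ n * (cell (torusIndex τ) k x).indicator 1 y) * (σ y * g y) := by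
              gcongr
              exact hC t ht ht1 x y
          _ = _ := by
              simp_rw [mul_assoc (C : ℝ≥0∞), ← ENNReal.tsum_mul_right, mul_assoc (scaleWeight t _),
                Finset.sum_mul]
    _ = C * ∑' k, scaleWeight t k * ∑ τ : Fin n → Bool,
          (2 ^ k) ^ n * ∫⁻ y in cell (torusIndex τ) k x, σ y * g y := by
        have hms : ∀ k, Measurable fun y => ∑ τ : Fin n → Bool,
            (2 ^ k) ^ n * (cell (torusIndex τ) k x).indicator 1 y * (σ y * g y) := fun k =>
          Finset.measurable_sum _ fun τ _ => hmeas τ k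
        rw [lintegral_const_mul _ (Measurable.tsum fun k => (hms k).const_mul _),
          lintegral_tsum fun k => ((hms k).const_mul _).aemeasurable]
        congr 1
        refine tsum_congr fun k => ?_
        rw [lintegral_const_mul _ (hms k), lintegral_finsetSum _ fun τ _ => hmeas τ k]
        congr 1
        refine Finset.sum_congr rfl fun τ _ => ?_
        simp_rw [mul_assoc]
        refine (lintegral_const_mul _ (f := fun y =>
          (cell (torusIndex τ) k x).indicator 1 y * (σ y * g y))
          ((measurable_one.indicator (hcell τ k)).mul (hσ.mul hg))).trans ?_
        rw [← lintegral_indicator (hcell τ k)]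
        congr 1
        refine lintegral_congr fun y => ?_
        by_cases hy : y ∈ cell (torusIndex τ) k x <;> simp [hy]
    _ ≤ C * ∑' k, scaleWeight t k * ∑ τ : Fin n → Bool,
          2 ^ n * (cellMaximal volume (torusIndex τ) σ x *
            cellMaximal (volume.withDensity σ) (torusIndex τ) g x) := by
        exact mul_le_mul_of_nonneg_left (ENNReal.tsum_le_tsum fun k => mul_le_mul_of_nonneg_left
          (Finset.sum_le_sum fun τ _ => hterm τ k) zero_le) zero_le
    _ ≤ C * (2 * ∑ τ : Fin n → Bool, 2 ^ n * (cellMaximal volume (torusIndex τ) σ x *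
            cellMaximal (volume.withDensity σ) (torusIndex τ) g x)) := by
        rw [ENNReal.tsum_mul_right]
        gcongr
        exact tsum_scaleWeight_le ht ht1
    _ = _ := by
        rw [← Finset.mul_sum]
        push_cast
        ring

/-! ### Heat convolutions of integrable functions. -/

variable {n : ℕ}

theorem volume_torus_univ : volume (Set.univ : Set (Torus n)) = 1 := by
  rw [volume_pi, Measure.pi_univ]
  simp

theorem heatKernel_neg {t : ℝ} (ht : 0 < t) (x : Torus n) :
    heatKernel t (-x) = heatKernel t x := by
  simp [heatKernel_eq_prod ht, circleKernel]

theorem integral_heatKernel_sub {t : ℝ} (ht : 0 < t) (x : Torus n) :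
    ∫ y, heatKernel t (x - y) = 1 := by
  simp_rw [fun y => (neg_sub y x ▸ heatKernel_neg ht (y - x) :
    heatKernel t (x - y) = heatKernel t (y - x))]
  rw [integral_sub_right_eq_self (heatKernel t) x, integral_heatKernel ht]

theorem continuous_heatKernel_sub {t : ℝ} (ht : 0 < t) :
    Continuous fun z : Torus n × Torus n => (heatKernel t (z.1 - z.2) : ℂ) :=
  Complex.continuous_ofReal.comp ((continuous_heatKernel ht).comp (continuous_fst.sub continuous_snd))

theorem aestronglyMeasurable_heatKernel_sub {t : ℝ} (ht : 0 < t) (x : Torus n) :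
    AEStronglyMeasurable (fun y => (heatKernel t (x - y) : ℂ)) volume :=
  ((continuous_heatKernel_sub ht).comp (Continuous.prodMk_right x)).aestronglyMeasurable

theorem heatConvFinite_of_integrable {f : Torus n → ℂ} (hf : Integrable f) {t : ℝ} (ht : 0 < t)
    (x : Torus n) : HeatConvFinite t f x := by
  obtain ⟨c, C, hc, hb⟩ := exists_heatKernel_bounds (n := n) ht
  refine hf.bdd_mul (c := C) (aestronglyMeasurable_heatKernel_sub ht x) (Eventually.of_forall fun y => ?_)
  rw [Complex.norm_real, Real.norm_of_nonneg (heatKernel_pos ht _).le]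
  exact (hb _).2

/-- The kernel is bounded below by a positive constant on the compact torus, so one point of
finiteness controls the whole `L¹` norm. -/
theorem integrable_of_heatConvFinite {f : Torus n → ℂ} (hf : AEStronglyMeasurable f volume) {t : ℝ}
    (ht : 0 < t) {x : Torus n} (h : HeatConvFinite t f x) : Integrable f := by
  obtain ⟨c, C, hc, hb⟩ := exists_heatKernel_bounds (n := n) ht
  refine Integrable.mono' (h.norm.const_mul c⁻¹) hf (Eventually.of_forall fun y => ?_)
  rw [norm_mul, Complex.norm_real, Real.norm_of_nonneg (heatKernel_pos ht _).le, ← mul_assoc]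
  refine le_mul_of_one_le_left (norm_nonneg _) ?_
  rw [inv_mul_eq_div, one_le_div hc]
  exact (hb _).1

theorem enorm_heatConv_le {t : ℝ} (ht : 0 < t) (f : Torus n → ℂ) (x : Torus n) :
    ‖heatConv t f x‖ₑ ≤ ∫⁻ y, ENNReal.ofReal (heatKernel t (x - y)) * ‖f y‖ₑ := by
  refine (enorm_integral_le_lintegral_enorm _).trans (lintegral_mono fun y => ?_)
  rw [enorm_mul]
  gcongr
  rw [← ofReal_norm, Complex.norm_real, Real.norm_of_nonneg (heatKernel_pos ht _).le]

theorem continuous_heatConv {f : Torus n → ℂ} (hf : Integrable f) {t : ℝ} (ht : 0 < t) :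
    Continuous (heatConv t f) := by
  obtain ⟨c, C, hc, hb⟩ := exists_heatKernel_bounds (n := n) ht
  refine continuous_of_dominated (bound := fun y => C * ‖f y‖)
    (fun x => (aestronglyMeasurable_heatKernel_sub ht x).mul hf.1)
    (fun x => Eventually.of_forall fun y => ?_) (hf.norm.const_mul C)
    (Eventually.of_forall fun y => ?_)
  · rw [norm_mul, Complex.norm_real, Real.norm_of_nonneg (heatKernel_pos ht _).le]
    gcongr
    exact (hb _).2
  · exact ((continuous_heatKernel_sub ht).comp (Continuous.prodMk_left y)).mul continuous_const

theorem heatMaximal_eq_of_integrable {f : Torus n → ℂ} (hf : Integrable f) (R : ℝ) :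
    heatMaximal R f = fun x => ⨆ t ∈ Set.Ioo (0 : ℝ) R, ‖heatConv t f x‖ₑ := by
  funext x
  refine iSup_congr fun t => iSup_congr fun ht => ?_
  rw [if_pos (heatConvFinite_of_integrable hf ht.1 x)]

theorem measurable_heatMaximal {f : Torus n → ℂ} (hf : Integrable f) (R : ℝ) :
    Measurable (heatMaximal R f) := by
  rw [heatMaximal_eq_of_integrable hf]
  -- The supremum is over uncountably many `t`; lower semicontinuity replaces a reduction to
  -- countably many.
  exact (lowerSemicontinuous_biSup fun t ht =>
    (continuous_heatConv hf ht.1).enorm.lowerSemicontinuous).measurable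

theorem exists_heatMaximal_le (n : ℕ) : ∃ C : ℝ≥0, ∀ {σ g : Torus n → ℝ≥0∞}, Measurable σ →
    Measurable g → ∫⁻ x, σ x ≠ ∞ → ∀ {f : Torus n → ℂ}, Integrable f →
      (∀ᵐ y, ‖f y‖ₑ = σ y * g y) → ∀ {R : ℝ}, R ≤ 1 → ∀ x, heatMaximal R f x ≤
        C * ∑ τ : Fin n → Bool, cellMaximal volume (torusIndex τ) σ x *
          cellMaximal (volume.withDensity σ) (torusIndex τ) g x := by
  obtain ⟨C, hC⟩ := exists_lintegral_heatKernel_mul_le n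
  refine ⟨C, fun {σ g} hσ hg hσ1 f hf hfg R hR x => ?_⟩
  rw [heatMaximal_eq_of_integrable hf]
  refine iSup₂_le fun t ht => (enorm_heatConv_le ht.1 f x).trans ?_
  refine (lintegral_mono_ae ?_).trans (hC hσ hg hσ1 t ht.1 (ht.2.le.trans hR) x)
  filter_upwards [hfg] with y hy
  rw [hy]

/-! ### The weak type bound and almost everywhere convergence. -/

/-- The local heat maximal operator is of weak type `(1, 1)`. -/
theorem exists_mul_meas_heatMaximal_le (n : ℕ) : ∃ C : ℝ≥0, ∀ {f : Torus n → ℂ}, Integrable f →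
    ∀ {R : ℝ}, R ≤ 1 → ∀ l : ℝ≥0∞, l * volume {x | l < heatMaximal R f x} ≤ C * ∫⁻ x, ‖f x‖ₑ := by
  obtain ⟨C, hC⟩ := exists_heatMaximal_le n
  set N : ℝ≥0 := (Fintype.card (Fin n → Bool) : ℝ≥0) with hN
  -- `C + 1` rather than `C`, so that `A` may be divided by.
  set A : ℝ≥0 := (C + 1) * N with hA
  have hN0 : N ≠ 0 := by simp [hN]
  have hA0 : (A : ℝ≥0∞) ≠ 0 := by simp [hA, hN0]
  refine ⟨A * N, fun {f} hf R hR l => ?_⟩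
  obtain ⟨g, hg, hgf⟩ : ∃ g : Torus n → ℝ≥0∞, Measurable g ∧ ∀ᵐ x, ‖f x‖ₑ = g x :=
    ⟨_, hf.1.enorm.measurable_mk, hf.1.enorm.ae_eq_mk⟩
  -- With `σ = 1` the factor `M_τ σ` is at most one, and only the dyadic maximal functions of `|f|`
  -- remain.
  have hle := hC (σ := 1) measurable_one hg
    (by simp [volume_torus_univ]) hf (by simpa using hgf) hR
  rw [withDensity_one] at hle
  have hM1 : ∀ (τ : Fin n → Bool) x, cellMaximal volume (torusIndex τ) 1 x ≤ 1 := fun τ x => by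
    refine iSup_le fun k => ?_
    simp [cellAverage, ENNReal.div_self_le_one]
  have hsub : {x | l < heatMaximal R f x} ⊆
      ⋃ τ : Fin n → Bool, {x | l / A < cellMaximal volume (torusIndex τ) g x} := by
    intro x hx
    by_contra hcon
    simp only [Set.mem_iUnion, Set.mem_ofPred_eq, not_exists, not_lt] at hcon
    refine absurd (show l < heatMaximal R f x from hx) (not_lt.2 ?_)
    calc heatMaximal R f x ≤ (C + 1 : ℝ≥0) * ∑ τ : Fin n → Bool,
          cellMaximal volume (torusIndex τ) 1 x * cellMaximal volume (torusIndex τ) g x := by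
          refine (hle x).trans ?_
          gcongr
          simp
      _ ≤ (C + 1 : ℝ≥0) * ∑ _τ : Fin n → Bool, 1 * (l / A) := by
          refine mul_le_mul_of_nonneg_left (Finset.sum_le_sum fun τ _ => ?_) zero_le
          exact mul_le_mul' (hM1 τ x) (hcon τ)
      _ = A * (l / A) := by
          simp only [one_mul, Finset.sum_const, Finset.card_univ, nsmul_eq_mul, ← mul_assoc, hA, hN]
          push_cast
          rfl
      _ ≤ l := ENNReal.mul_div_le
  calc l * volume {x | l < heatMaximal R f x}
      = A * (l / A * volume {x | l < heatMaximal R f x}) := by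
        rw [← mul_assoc, ENNReal.mul_div_cancel hA0 ENNReal.coe_ne_top]
    _ ≤ A * (l / A * ∑ τ : Fin n → Bool,
          volume {x | l / A < cellMaximal volume (torusIndex τ) g x}) := by
        gcongr
        exact (measure_mono hsub).trans (measure_iUnion_fintype_le _ _)
    _ ≤ A * ∑ _τ : Fin n → Bool, ∫⁻ x, g x := by
        rw [Finset.mul_sum]
        refine mul_le_mul_of_nonneg_left (Finset.sum_le_sum fun τ _ => ?_) zero_le
        exact (mul_meas_cellMaximal_le volume (measurable_torusIndex τ) (isNested_torusIndex τ) g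
          _).trans (setLIntegral_le_lintegral _ _)
    _ = _ := by
        rw [lintegral_congr_ae hgf]
        simp only [Finset.sum_const, Finset.card_univ, nsmul_eq_mul, hN]
        push_cast
        ring

theorem tendsto_heatConv_of_continuousAt {f : Torus n → ℂ} (hf : Integrable f) {x : Torus n}
    (hx : ContinuousAt f x) :
    Tendsto (fun t : ℝ => heatConv t f x) (𝓝[>] 0) (𝓝 (f x)) := by
  have hpos : ∀ᶠ t : ℝ in 𝓝[>] 0, 0 < t := self_mem_nhdsWithin
  refine tendsto_integral_peak_smul_of_integrable_of_tendsto (t := Set.univ)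
    (φ := fun t y => heatKernel t (x - y)) (g := f) (x₀ := x) (μ := volume)
    MeasurableSet.univ univ_mem (measure_ne_top _ _) ?_ ?_ ?_ ?_ hf hx |>.congr fun t => ?_
  · filter_upwards [hpos] with t ht y using (heatKernel_pos ht _).le
  · intro u hu hxu
    obtain ⟨δ, hδ, hball⟩ := Metric.isOpen_iff.1 hu x hxu
    obtain ⟨C, hC, hle⟩ := exists_heatKernel_le n
    rw [Metric.tendstoUniformlyOn_iff]
    intro ε hε
    -- At distance at least `δ` from `x` the kernel is at most `C √t / δ^{n+1}`, so its mass
    -- concentrates at `x`.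
    have hlim : Tendsto (fun t : ℝ => C * √t / δ ^ (n + 1)) (𝓝[>] 0) (𝓝 0) := by
      have : Tendsto (fun t : ℝ => C * √t / δ ^ (n + 1)) (𝓝 0) (𝓝 (C * √0 / δ ^ (n + 1))) :=
        Continuous.tendsto (by fun_prop) 0
      simpa using this.mono_left nhdsWithin_le_nhds
    filter_upwards [hpos, hlim.eventually_lt_const hε,
      mem_nhdsWithin_of_mem_nhds (Iic_mem_nhds one_pos)] with t ht htε ht1 y hy
    have hd : δ ≤ ‖x - y‖ := by
      rw [← dist_eq_norm, dist_comm]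
      exact not_lt.1 fun h => hy (hball h)
    rw [Pi.zero_apply, dist_zero_left, Real.norm_of_nonneg (heatKernel_pos ht _).le]
    refine lt_of_le_of_lt ((hle t ht ht1 (x - y)).trans ?_) htε
    gcongr
    exact hd.trans (le_add_of_nonneg_left (Real.sqrt_nonneg t))
  · refine Tendsto.congr' ?_ tendsto_const_nhds
    filter_upwards [hpos] with t ht
    rw [Measure.restrict_univ, integral_heatKernel_sub ht]
  · filter_upwards [hpos] with t ht
    exact ((continuous_heatKernel ht).comp (continuous_const.sub continuous_id)).aestronglyMeasurable
  · simp [heatConv]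

theorem heatConv_add {f g : Torus n → ℂ} (hf : Integrable f) (hg : Integrable g) {t : ℝ}
    (ht : 0 < t) (x : Torus n) :
    heatConv t (fun y => f y + g y) x = heatConv t f x + heatConv t g x := by
  unfold heatConv
  simp_rw [mul_add]
  exact integral_add (heatConvFinite_of_integrable hf ht x) (heatConvFinite_of_integrable hg ht x)

/-- If `f` is well approximated at `x` by functions continuous at `x`, up to errors with small heat
maximal function, then `φ_t * f (x)` tends to `f x`. -/
theorem tendsto_heatConv_of_approx {f : Torus n → ℂ} {x : Torus n}
    (h : ∀ ε : ℝ, 0 < ε → ∃ g b : Torus n → ℂ, Integrable g ∧ Integrable b ∧ ContinuousAt g x ∧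
      (∀ y, f y = g y + b y) ∧ heatMaximal 1 b x ≤ ENNReal.ofReal ε ∧ ‖b x‖ₑ ≤ ENNReal.ofReal ε) :
    Tendsto (fun t : ℝ => heatConv t f x) (𝓝[>] 0) (𝓝 (f x)) := by
  rw [Metric.tendsto_nhds]
  intro ε hε
  obtain ⟨g, b, hg, hb, hgx, hfgb, hH, hbx⟩ := h (ε / 4) (by positivity)
  have hlim := Metric.tendsto_nhds.1 (tendsto_heatConv_of_continuousAt hg hgx) (ε / 4)
    (by positivity)
  filter_upwards [hlim, self_mem_nhdsWithin, mem_nhdsWithin_of_mem_nhds (Iio_mem_nhds one_pos)]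
    with t h1 ht ht1
  have h2 : ‖heatConv t b x‖ ≤ ε / 4 := by
    rw [heatMaximal_eq_of_integrable hb] at hH
    have h3 : ‖heatConv t b x‖ₑ ≤ ENNReal.ofReal (ε / 4) :=
      (le_iSup₂ (f := fun (t : ℝ) (_ : t ∈ Set.Ioo (0 : ℝ) 1) => ‖heatConv t b x‖ₑ) t
        ⟨ht, ht1⟩).trans hH
    rwa [← ofReal_norm, ENNReal.ofReal_le_ofReal_iff (by positivity)] at h3
  have h4 : ‖b x‖ ≤ ε / 4 := by
    rwa [← ofReal_norm, ENNReal.ofReal_le_ofReal_iff (by positivity)] at hbx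
  rw [dist_eq_norm] at h1 ⊢
  rw [funext hfgb, heatConv_add hg hb ht]
  calc ‖heatConv t g x + heatConv t b x - (g x + b x)‖
      = ‖(heatConv t g x - g x) + (heatConv t b x - b x)‖ := by ring_nf
    _ ≤ ‖heatConv t g x - g x‖ + (‖heatConv t b x‖ + ‖b x‖) :=
        (norm_add_le _ _).trans (by gcongr; exact norm_sub_le _ _)
    _ < ε := by linarith

/-- Choose continuous `g j` within `4⁻ʲ` of `f` in `L¹`. By the weak type bound and Markov's
inequality, the sets where the maximal function of `f - g j`, or `|f - g j|` itself, exceeds `2⁻ʲ`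
have measure `O(2⁻ʲ)`; Borel–Cantelli then provides good approximations at almost every point. -/
theorem ae_tendsto_heatConv {f : Torus n → ℂ} (hf : Integrable f) :
    ∀ᵐ x, Tendsto (fun t : ℝ => heatConv t f x) (𝓝[>] 0) (𝓝 (f x)) := by
  obtain ⟨C, hC⟩ := exists_mul_meas_heatMaximal_le n
  choose g hg1 hg2 using fun j : ℕ => hf.exists_boundedContinuous_lintegral_sub_le
    (ε := (2⁻¹ : ℝ≥0∞) ^ j * (2⁻¹ : ℝ≥0∞) ^ j) (by simp)
  set b : ℕ → Torus n → ℂ := fun j x => f x - g j x with hb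
  have hbi : ∀ j, Integrable (b j) := fun j => hf.sub (hg2 j)
  have hhalf : ∀ j : ℕ, ((2⁻¹ : ℝ≥0∞) ^ j) ≠ 0 := fun j => by simp
  have hhalf' : ∀ j : ℕ, ((2⁻¹ : ℝ≥0∞) ^ j) ≠ ∞ := fun j => by simp
  have hdiv : ∀ (j : ℕ) (s : Set (Torus n)) (D : ℝ≥0∞), (2⁻¹ : ℝ≥0∞) ^ j * volume s ≤
      D * ∫⁻ x, ‖b j x‖ₑ → volume s ≤ D * (2⁻¹ : ℝ≥0∞) ^ j := fun j s D h => by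
    rw [← ENNReal.mul_le_mul_iff_right (hhalf j) (hhalf' j)]
    refine h.trans ?_
    calc D * ∫⁻ x, ‖b j x‖ₑ ≤ D * ((2⁻¹ : ℝ≥0∞) ^ j * (2⁻¹ : ℝ≥0∞) ^ j) := by
          gcongr
          exact hg1 j
      _ = _ := by ring
  have hsum : ∀ D : ℝ≥0, ∑' j : ℕ, (D : ℝ≥0∞) * (2⁻¹ : ℝ≥0∞) ^ j ≠ ∞ := fun D => by
    rw [ENNReal.tsum_mul_left, ENNReal.tsum_geometric]
    exact ENNReal.mul_ne_top ENNReal.coe_ne_top (by simp)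
  have h1 : ∀ᵐ x, ∀ᶠ j in atTop, x ∉ {x | (2⁻¹ : ℝ≥0∞) ^ j < heatMaximal 1 (b j) x} :=
    ae_eventually_notMem (ne_top_of_le_ne_top (hsum C) (ENNReal.tsum_le_tsum fun j =>
      hdiv j _ _ (hC (hbi j) le_rfl _)))
  have h2 : ∀ᵐ x, ∀ᶠ j in atTop, x ∉ {x | (2⁻¹ : ℝ≥0∞) ^ j ≤ ‖b j x‖ₑ} :=
    ae_eventually_notMem (ne_top_of_le_ne_top (hsum 1) (ENNReal.tsum_le_tsum fun j =>
      hdiv j _ _ (by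
        rw [ENNReal.coe_one, one_mul]
        exact mul_meas_ge_le_lintegral₀ (hbi j).1.enorm _)))
  filter_upwards [h1, h2] with x hx1 hx2
  refine tendsto_heatConv_of_approx fun ε hε => ?_
  have hlim : ∀ᶠ j : ℕ in atTop, (2⁻¹ : ℝ≥0∞) ^ j < ENNReal.ofReal ε :=
    (ENNReal.tendsto_pow_atTop_nhds_zero_of_lt_one (by simp)).eventually_lt_const
      (ENNReal.ofReal_pos.2 hε)
  obtain ⟨j, hj1, hj2, hj3⟩ := (hx1.and (hx2.and hlim)).exists
  exact ⟨g j, b j, hg2 j, hbi j, (g j).continuous.continuousAt, fun y => by simp [hb],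
    (not_lt.1 hj1).trans hj3.le, (not_le.1 hj2).le.trans hj3.le⟩

/-! ### Weighted spaces, the class `D^T_p` and the embedding into `L¹`. -/

theorem weightedNorm_rpow {E : Type*} [ENorm E] {p : ℝ} (hp : 0 < p) {w : Torus n → ℝ}
    (hw : ∀ᵐ x, 0 < w x) (g : Torus n → E) :
    weightedNorm p w g ^ p = ∫⁻ x, ‖g x‖ₑ ^ p * ENNReal.ofReal (w x) := by
  rw [weightedNorm, eLpNorm_eq_lintegral_rpow_enorm_toReal (by simpa using hp) (by simp),
    ENNReal.toReal_ofReal hp.le, ← ENNReal.rpow_mul, one_div_mul_cancel hp.ne', ENNReal.rpow_one]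
  refine lintegral_congr_ae ?_
  filter_upwards [hw] with x hx
  rw [enorm_eq_self, ENNReal.mul_rpow_of_nonneg _ _ hp.le,
    ENNReal.ofReal_rpow_of_nonneg (by positivity) hp.le, ← Real.rpow_mul hx.le,
    one_div_mul_cancel hp.ne', Real.rpow_one]

theorem classD_iff {p : ℝ} {v : Torus n → ℝ} (hv : IsWeight v) :
    ClassD p v ↔ MemLp (fun x => v x ^ (-(1 / p)))
      (ENNReal.conjExponent (ENNReal.ofReal p)) volume := by
  have hm : AEStronglyMeasurable (fun x => v x ^ (-(1 / p))) volume :=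
    (hv.1.pow_const _).aestronglyMeasurable
  constructor
  · rintro ⟨t, ht, h⟩
    obtain ⟨c, C, hc, hb⟩ := exists_heatKernel_bounds (n := n) ht
    refine h.of_le_mul (c := c⁻¹) hm (Eventually.of_forall fun x => ?_)
    rw [norm_mul, Real.norm_of_nonneg (heatKernel_pos ht x).le, mul_left_comm]
    refine le_mul_of_one_le_right (norm_nonneg _) ?_
    rw [inv_mul_eq_div, one_le_div hc]
    exact (hb x).1
  · intro h
    obtain ⟨c, C, hc, hb⟩ := exists_heatKernel_bounds (n := n) one_pos
    refine ⟨1, one_pos, h.of_le_mul (c := C)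
      (hm.mul (continuous_heatKernel one_pos).aestronglyMeasurable)
      (Eventually.of_forall fun x => ?_)⟩
    rw [norm_mul, Real.norm_of_nonneg (heatKernel_pos one_pos x).le, mul_comm]
    gcongr
    exact (hb x).2

/-- For `v` in `D^T_p`, the space `L^p_v` embeds continuously into `L^1`. -/
theorem lintegral_enorm_le_weightedNorm {p : ℝ} (hp : 1 ≤ p) {v : Torus n → ℝ} (hv : IsWeight v)
    {f : Torus n → ℂ} (hf : AEStronglyMeasurable f volume) :
    ∫⁻ x, ‖f x‖ₑ ≤ eLpNorm (fun x => v x ^ (-(1 / p)))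
      (ENNReal.conjExponent (ENNReal.ofReal p)) volume * weightedNorm p v f := by
  have : (ENNReal.ofReal p).HolderConjugate (ENNReal.ofReal p).conjExponent :=
    ENNReal.HolderConjugate.conjExponent (by simpa using hp)
  have : (ENNReal.ofReal p).conjExponent.HolderTriple (ENNReal.ofReal p) 1 :=
    ENNReal.HolderConjugate.symm
  -- Hölder is applied to `f = v^{-1/p} · (v^{1/p} f)`.
  set F : Torus n → ℂ := fun x => ((v x ^ (1 / p) : ℝ) : ℂ) * f x with hF
  have hFm : AEStronglyMeasurable F volume :=
    (Complex.continuous_ofReal.comp_aestronglyMeasurable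
      (hv.1.pow_const (1 / p)).aestronglyMeasurable).mul hf
  have h1 : weightedNorm p v f = eLpNorm F (ENNReal.ofReal p) volume := by
    refine eLpNorm_congr_enorm_ae ?_
    filter_upwards [hv.2] with x hx
    rw [enorm_eq_self, hF, enorm_mul, mul_comm, ← ofReal_norm ((v x ^ (1 / p) : ℝ) : ℂ),
      Complex.norm_real, Real.norm_of_nonneg (by positivity)]
  have h2 : ∫⁻ x, ‖f x‖ₑ = eLpNorm ((fun x => v x ^ (-(1 / p))) • F) 1 volume := by
    rw [eLpNorm_one_eq_lintegral_enorm]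
    refine lintegral_congr_ae ?_
    filter_upwards [hv.2] with x hx
    simp only [Pi.smul_apply', hF, Complex.real_smul]
    rw [← mul_assoc, ← Complex.ofReal_mul, ← Real.rpow_add hx]
    simp
  rw [h1, h2]
  exact eLpNorm_smul_le_mul_eLpNorm hFm (hv.1.pow_const _).aestronglyMeasurable

theorem integrable_of_memWeightedLp {p : ℝ} (hp : 1 ≤ p) {v : Torus n → ℝ} (hv : IsWeight v)
    (hD : ClassD p v) {f : Torus n → ℂ} (hf : MemWeightedLp p v f) : Integrable f :=
  ⟨hf.1, (lintegral_enorm_le_weightedNorm hp hv hf.1).trans_lt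
    (ENNReal.mul_lt_top ((classD_iff hv).1 hD).2 hf.2)⟩

theorem mapsWeak_one {v : Torus n → ℝ} (hv : IsWeight v) (hD : ClassD 1 v) {R : ℝ} (hR : R ≤ 1) :
    MapsWeak 1 v (fun _ => 1) (heatMaximal R) := by
  obtain ⟨C, hC⟩ := exists_mul_meas_heatMaximal_le n
  have hA := ((classD_iff hv).1 hD).2
  refine ⟨C * (eLpNorm (fun x => v x ^ (-(1 / 1 : ℝ)))
    (ENNReal.conjExponent (ENNReal.ofReal 1)) volume).toNNReal, fun f hf => ?_⟩
  have hfi := integrable_of_memWeightedLp le_rfl hv hD hf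
  refine ⟨(measurable_heatMaximal hfi R).aestronglyMeasurable, fun l => ?_⟩
  have hw : weightMeasure (fun _ : Torus n => (1 : ℝ)) = volume := by
    simp [weightMeasure]
  rw [hw, ENNReal.rpow_one, ENNReal.rpow_one, ENNReal.coe_mul, ENNReal.coe_toNNReal hA.ne,
    mul_assoc]
  refine (hC hfi hR l).trans ?_
  gcongr
  exact lintegral_enorm_le_weightedNorm le_rfl hv hf.1

/-! ### The strong type bound for `p > 1`. -/

theorem conjExponent_ofReal {p : ℝ} (hp : 1 < p) :
    ENNReal.conjExponent (ENNReal.ofReal p) = ENNReal.ofReal (p / (p - 1)) := by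
  have hp1 : 0 < p - 1 := by linarith
  rw [ENNReal.conjExponent, ← ENNReal.ofReal_one, ← ENNReal.ofReal_sub _ zero_le_one,
    ← ENNReal.ofReal_inv_of_pos hp1, ← ENNReal.ofReal_add zero_le_one (by positivity)]
  congr 1
  field_simp
  ring

theorem exists_mapsStrong {p : ℝ} (hp : 1 < p) {v : Torus n → ℝ} (hv : IsWeight v)
    (hD : ClassD p v) {R : ℝ} (hR : R ≤ 1) :
    ∃ u : Torus n → ℝ, IsWeight u ∧ MapsStrong p v u (heatMaximal R) := by
  obtain ⟨C, hC⟩ := exists_heatMaximal_le n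
  obtain ⟨K, hK⟩ := exists_lintegral_cellMaximal_rpow_le (X := Torus n) (ι := Fin n → ℤ) hp
  have hp0 : 0 < p := by linarith
  have hp1 : 0 < p - 1 := by linarith
  -- `σ = (v^{-1/p})^{p'}`, so `ClassD` says exactly that `σ` is integrable. A measurable
  -- representative of `v` makes `σ` measurable, as the maximal function lemmas require.
  set σ : Torus n → ℝ≥0∞ := fun x => ENNReal.ofReal (hv.1.mk v x ^ (-(1 / (p - 1)))) with hσdef
  have hσ : Measurable σ := (hv.1.measurable_mk.pow_const _).ennreal_ofReal
  have hσv : ∀ᵐ x, σ x = ENNReal.ofReal (v x ^ (-(1 / (p - 1)))) := by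
    filter_upwards [hv.1.ae_eq_mk] with x hx
    rw [hσdef, hx]
  have hσpos : ∀ᵐ x, σ x ≠ 0 := by
    filter_upwards [hσv, hv.2] with x hx hx0
    rw [hx]
    exact (ENNReal.ofReal_pos.2 (by positivity)).ne'
  have hσtop : ∀ x, σ x ≠ ∞ := fun x => ENNReal.ofReal_ne_top
  have hq := conjExponent_ofReal hp
  have hq0 : 0 < p / (p - 1) := by positivity
  have hσ1 : ∫⁻ x, σ x ≠ ∞ := by
    have h := ((classD_iff hv).1 hD).2
    rw [hq] at h
    have h2 := lintegral_rpow_enorm_lt_top_of_eLpNorm_lt_top (by simpa using hq0) (by simp) h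
    rw [ENNReal.toReal_ofReal hq0.le] at h2
    refine ne_top_of_le_ne_top h2.ne (lintegral_mono_ae ?_)
    filter_upwards [hσv, hv.2] with x hx hx0
    rw [hx, ← ofReal_norm, Real.norm_of_nonneg (by positivity),
      ENNReal.ofReal_rpow_of_nonneg (by positivity) hq0.le, ← Real.rpow_mul hx0.le]
    refine le_of_eq ?_
    congr 2
    field_simp
  have hσ0 : ∫⁻ x, σ x ≠ 0 := by
    intro h
    rw [lintegral_eq_zero_iff hσ] at h
    have hF : ∀ᵐ x : Torus n, False := by
      filter_upwards [h, hσpos] with x h1 h2 using h2 h1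
    have : (volume : Measure (Torus n)) Set.univ = 0 := by
      simpa [ae_iff] using hF
    rw [volume_torus_univ] at this
    exact one_ne_zero this
  set S : Torus n → ℝ≥0∞ := fun x => ∑ τ : Fin n → Bool, cellMaximal volume (torusIndex τ) σ x
    with hS
  have hSm : Measurable S := Finset.measurable_sum _ fun τ _ =>
    measurable_cellMaximal volume (measurable_torusIndex τ) σ
  have hStop : ∀ᵐ x, S x ≠ ∞ := by
    have h : ∀ᵐ x, ∀ τ : Fin n → Bool, cellMaximal volume (torusIndex τ) σ x < ∞ :=
      ae_all_iff.2 fun τ =>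
        cellMaximal_lt_top volume (measurable_torusIndex τ) (isNested_torusIndex τ) hσ1
    filter_upwards [h] with x hx
    exact ENNReal.sum_ne_top.2 fun τ _ => (hx τ).ne
  -- The only cell of generation zero is the whole torus, where the average of `σ` is `∫ σ > 0`.
  have hS0 : ∀ x, S x ≠ 0 := by
    intro x h
    have h1 : cellMaximal volume (torusIndex fun _ : Fin n => false) σ x = 0 :=
      (Finset.sum_eq_zero_iff.1 h) _ (Finset.mem_univ _)
    have h2 : cell (torusIndex fun _ : Fin n => false) 0 x = Set.univ := by
      ext y
      simp [cell, torusIndex, funext_iff, circleIndex_zero]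
    have h3 : cellAverage volume (torusIndex fun _ : Fin n => false) σ 0 x = 0 :=
      le_antisymm (h1 ▸ le_iSup (fun k =>
        cellAverage volume (torusIndex fun _ : Fin n => false) σ k x) 0) zero_le
    rw [cellAverage, h2, volume_torus_univ, Measure.restrict_univ, div_one] at h3
    exact hσ0 h3
  -- Dividing by `S^p` cancels the factor `S` in `H*_R f ≤ C S G`, leaving the norm of `G` in
  -- `L^p(σ)`.
  set u : Torus n → ℝ := fun x => (σ x / S x ^ p).toReal with hu
  have huw : IsWeight u := by
    refine ⟨(hσ.div (hSm.pow_const p)).ennreal_toReal.aemeasurable, ?_⟩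
    filter_upwards [hσpos, hStop] with x h1 h2
    refine ENNReal.toReal_pos (ENNReal.div_ne_zero.2 ⟨h1, ENNReal.rpow_ne_top_of_nonneg hp0.le h2⟩)
      (ENNReal.div_ne_top (hσtop x) ?_)
    simp [ENNReal.rpow_eq_zero_iff, hS0 x, hp0.le.not_gt]
  set N : ℝ≥0∞ := ((Finset.univ : Finset (Fin n → Bool)).card : ℝ≥0∞) ^ (p - 1) with hN
  have hNtop : N ≠ ∞ := ENNReal.rpow_ne_top_of_nonneg hp1.le (by simp)
  set D : ℝ≥0∞ := (C : ℝ≥0∞) ^ p * (N * ((Finset.univ : Finset (Fin n → Bool)).card * K)) with hDdef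
  have hDtop : D ≠ ∞ := ENNReal.mul_ne_top (ENNReal.rpow_ne_top_of_nonneg hp0.le (by simp))
    (ENNReal.mul_ne_top hNtop (ENNReal.mul_ne_top (by simp) (by simp)))
  refine ⟨u, huw, (D ^ (1 / p)).toNNReal, fun f hf => ?_⟩
  have hfi := integrable_of_memWeightedLp hp.le hv hD hf
  have hHm := measurable_heatMaximal hfi R
  set F : Torus n → ℝ≥0∞ := hf.1.enorm.mk _ with hF
  have hFf : ∀ᵐ x, ‖f x‖ₑ = F x := hf.1.enorm.ae_eq_mk
  set g : Torus n → ℝ≥0∞ := fun x => F x / σ x with hg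
  have hgm : Measurable g := hf.1.enorm.measurable_mk.div hσ
  have hfg : ∀ᵐ x, ‖f x‖ₑ = σ x * g x := by
    filter_upwards [hFf, hσpos] with x h1 h2
    rw [h1, hg, ENNReal.mul_div_cancel h2 (hσtop x)]
  have hfin : IsFiniteMeasure (volume.withDensity σ) := isFiniteMeasure_withDensity hσ1
  set G : Torus n → ℝ≥0∞ := fun x => ∑ τ : Fin n → Bool,
    cellMaximal (volume.withDensity σ) (torusIndex τ) g x with hG
  have hcm : ∀ τ : Fin n → Bool,
      Measurable (cellMaximal (volume.withDensity σ) (torusIndex τ) g) := fun τ =>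
    measurable_cellMaximal _ (measurable_torusIndex τ) g
  have hGm : Measurable G := Finset.measurable_sum _ fun τ _ => hcm τ
  have hHle : ∀ x, heatMaximal R f x ≤ C * (S x * G x) := fun x => by
    refine (hC hσ hgm hσ1 hfi hfg hR x).trans ?_
    gcongr
    rw [hG, Finset.mul_sum]
    refine Finset.sum_le_sum fun τ _ => ?_
    gcongr
    exact Finset.single_le_sum (f := fun τ : Fin n → Bool =>
      cellMaximal volume (torusIndex τ) σ x) (fun _ _ => zero_le) (Finset.mem_univ τ)
  have hpow : weightedNorm p u (heatMaximal R f) ^ p ≤ D * weightedNorm p v f ^ p := by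
    rw [weightedNorm_rpow hp0 huw.2, weightedNorm_rpow hp0 hv.2]
    calc ∫⁻ x, ‖heatMaximal R f x‖ₑ ^ p * ENNReal.ofReal (u x)
        ≤ ∫⁻ x, (C : ℝ≥0∞) ^ p * (σ x * G x ^ p) := by
          refine lintegral_mono fun x => ?_
          calc ‖heatMaximal R f x‖ₑ ^ p * ENNReal.ofReal (u x)
              ≤ (C * (S x * G x)) ^ p * (σ x / S x ^ p) := by
                rw [enorm_eq_self]
                gcongr
                · exact hHle x
                · exact ENNReal.ofReal_toReal_le
            _ = (C : ℝ≥0∞) ^ p * (S x ^ p * (σ x / S x ^ p) * G x ^ p) := by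
                rw [ENNReal.mul_rpow_of_nonneg _ _ hp0.le, ENNReal.mul_rpow_of_nonneg _ _ hp0.le]
                ring
            _ ≤ _ := by
                gcongr
                exact ENNReal.mul_div_le
      _ = (C : ℝ≥0∞) ^ p * ∫⁻ x, G x ^ p ∂(volume.withDensity σ) := by
          rw [lintegral_withDensity_eq_lintegral_mul _ hσ (hGm.pow_const p)]
          exact lintegral_const_mul _ (hσ.mul (hGm.pow_const p))
      _ ≤ (C : ℝ≥0∞) ^ p * ∫⁻ x, N * ∑ τ : Fin n → Bool,
            cellMaximal (volume.withDensity σ) (torusIndex τ) g x ^ p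
              ∂(volume.withDensity σ) := by
          gcongr with x
          exact ENNReal.rpow_sum_le_const_mul_sum_rpow _ _ hp.le
      _ = (C : ℝ≥0∞) ^ p * (N * ∑ τ : Fin n → Bool, ∫⁻ x,
            cellMaximal (volume.withDensity σ) (torusIndex τ) g x ^ p
              ∂(volume.withDensity σ)) := by
          rw [lintegral_const_mul _ (Finset.measurable_sum _ fun τ _ => (hcm τ).pow_const p),
            lintegral_finsetSum _ fun τ _ => (hcm τ).pow_const p]
      _ ≤ (C : ℝ≥0∞) ^ p * (N * ∑ _τ : Fin n → Bool,
            K * ∫⁻ x, g x ^ p ∂(volume.withDensity σ)) := by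
          refine mul_le_mul_of_nonneg_left (mul_le_mul_of_nonneg_left
            (Finset.sum_le_sum fun τ _ => ?_) zero_le) zero_le
          exact hK _ (measurable_torusIndex τ) (isNested_torusIndex τ) hgm
      _ = D * ∫⁻ x, σ x * g x ^ p := by
          rw [Finset.sum_const, nsmul_eq_mul,
            lintegral_withDensity_eq_lintegral_mul _ hσ (hgm.pow_const p), hDdef]
          simp only [Pi.mul_apply]
          ring
      _ = _ := by
          congr 1
          refine lintegral_congr_ae ?_
          filter_upwards [hfg, hσv, hv.2, hσpos] with x h1 h2 h3 h4
          -- The exponent of `σ` is the one with `σ^p v = σ`, which gives `σ g^p = |f|^p v`.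
          have h5 : σ x = σ x ^ p * ENNReal.ofReal (v x) := by
            rw [h2, ENNReal.ofReal_rpow_of_nonneg (by positivity) hp0.le, ← Real.rpow_mul h3.le,
              ← ENNReal.ofReal_mul (by positivity), ← Real.rpow_add_one h3.ne']
            congr 2
            field_simp
            ring
          rw [h1, ENNReal.mul_rpow_of_nonneg _ _ hp0.le]
          conv_lhs => rw [h5]
          ring
  have hle : weightedNorm p u (heatMaximal R f) ≤ D ^ (1 / p) * weightedNorm p v f := by
    rw [← ENNReal.rpow_le_rpow_iff hp0, ENNReal.mul_rpow_of_nonneg _ _ hp0.le, ← ENNReal.rpow_mul,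
      one_div_mul_cancel hp0.ne', ENNReal.rpow_one]
    exact hpow
  have hDp : D ^ (1 / p) ≠ ∞ := ENNReal.rpow_ne_top_of_nonneg (by positivity) hDtop
  rw [ENNReal.coe_toNNReal hDp]
  exact ⟨⟨hHm.aestronglyMeasurable, hle.trans_lt (ENNReal.mul_lt_top hDp.lt_top hf.2)⟩, hle⟩

/-! ### Converse of Hölder's inequality from mere finiteness. -/

section Duality

variable {X : Type*} [MeasurableSpace X] {μ : Measure X}

/-- If `∫ h W < ∞` for every `h` in `L^p`, then `∫ h W` is bounded on some ball of `L^p`. -/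
theorem exists_lintegral_mul_le_of_forall_ne_top {p : ℝ} (hp : 0 < p) {W : X → ℝ≥0∞}
    (H : ∀ h : X → ℝ≥0∞, Measurable h → ∫⁻ x, h x ^ p ∂μ ≠ ∞ → ∫⁻ x, h x * W x ∂μ ≠ ∞) :
    ∃ δ : ℝ≥0∞, δ ≠ 0 ∧ δ ≠ ∞ ∧ ∃ B : ℝ≥0∞, B ≠ ∞ ∧ ∀ h : X → ℝ≥0∞, Measurable h →
      ∫⁻ x, h x ^ p ∂μ ≤ δ → ∫⁻ x, h x * W x ∂μ ≤ B := by
  by_contra hcon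
  have hk : ∀ k : ℕ, ∃ h : X → ℝ≥0∞, Measurable h ∧ ∫⁻ x, h x ^ p ∂μ ≤ 2⁻¹ ^ k ∧
      (k : ℝ≥0∞) ≤ ∫⁻ x, h x * W x ∂μ := by
    intro k
    by_contra hc
    refine hcon ⟨2⁻¹ ^ k, by simp, by simp, k, by simp, fun h hm hle => ?_⟩
    by_contra hlt
    exact hc ⟨h, hm, hle, (not_le.1 hlt).le⟩
  choose h hm hle hge using hk
  -- Gliding hump: `(sup h_k)^p ≤ ∑ h_k^p` keeps the supremum in `L^p`, while its integral against
  -- `W` exceeds every `k`.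
  refine H (fun x => ⨆ k, h k x) (Measurable.iSup hm) ?_ ?_
  · have hbound : ∫⁻ x, (⨆ k, h k x) ^ p ∂μ ≤ ∑' k : ℕ, (2⁻¹ : ℝ≥0∞) ^ k :=
      calc ∫⁻ x, (⨆ k, h k x) ^ p ∂μ ≤ ∫⁻ x, ∑' k, h k x ^ p ∂μ := by
            refine lintegral_mono fun x => ?_
            rw [← ENNReal.le_rpow_inv_iff hp]
            refine iSup_le fun k => ?_
            rw [ENNReal.le_rpow_inv_iff hp]
            exact ENNReal.le_tsum (f := fun k => h k x ^ p) k
        _ = ∑' k, ∫⁻ x, h k x ^ p ∂μ := lintegral_tsum fun k => ((hm k).pow_const p).aemeasurable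
        _ ≤ _ := ENNReal.tsum_le_tsum hle
    refine ne_top_of_le_ne_top ?_ hbound
    rw [ENNReal.tsum_geometric]
    simp
  · refine ENNReal.eq_top_of_forall_nnreal_le fun r => ?_
    obtain ⟨k, hrk⟩ := exists_nat_ge r
    calc (r : ℝ≥0∞) ≤ k := by exact_mod_cast hrk
      _ ≤ ∫⁻ x, h k x * W x ∂μ := hge k
      _ ≤ _ := by
          gcongr with x
          exact le_iSup (fun k => h k x) k

/-- Test against the extremal function `c · min(W, N)^{q-1}` of Hölder's inequality. Truncation
makes its norm finite, so one may divide by it; then `N → ∞` by monotone convergence. -/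
theorem lintegral_rpow_conj_ne_top [IsFiniteMeasure μ] {p : ℝ} (hp : 1 < p) {W : X → ℝ≥0∞}
    (hW : Measurable W)
    (H : ∀ h : X → ℝ≥0∞, Measurable h → ∫⁻ x, h x ^ p ∂μ ≠ ∞ → ∫⁻ x, h x * W x ∂μ ≠ ∞) :
    ∫⁻ x, W x ^ (p / (p - 1)) ∂μ ≠ ∞ := by
  have hp0 : 0 < p := by linarith
  have hp1 : 0 < p - 1 := by linarith
  set q := p / (p - 1) with hq
  have hq0 : 0 < q := by positivity
  obtain ⟨δ, hδ0, hδ, B, hB, hbound⟩ := exists_lintegral_mul_le_of_forall_ne_top hp0 H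
  set T : ℕ → X → ℝ≥0∞ := fun N x => min (W x) N with hT
  have hTm : ∀ N, Measurable (T N) := fun N => hW.min measurable_const
  have hTpow : ∀ N x, T N x ^ (q - 1) * T N x = T N x ^ q := fun N x => by
    have h1 : q = (q - 1) + 1 := by ring
    conv_rhs => rw [h1]
    rw [ENNReal.rpow_add_of_nonneg _ _ _ zero_le_one, ENNReal.rpow_one]
    rw [hq, sub_nonneg, one_le_div hp1]
    linarith
  have hI : ∀ N, ∫⁻ x, T N x ^ q ∂μ ≤ (B / δ ^ (1 / p)) ^ q := by
    intro N
    set I := ∫⁻ x, T N x ^ q ∂μ with hIdef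
    have hItop : I ≠ ∞ := by
      refine ne_top_of_le_ne_top ?_ (lintegral_mono fun x =>
        ENNReal.rpow_le_rpow (min_le_right (W x) (N : ℝ≥0∞)) hq0.le)
      rw [lintegral_const]
      exact ENNReal.mul_ne_top (ENNReal.rpow_ne_top_of_nonneg hq0.le (by simp)) (measure_ne_top _ _)
    rcases eq_or_ne I 0 with hI0 | hI0
    · rw [hI0]
      exact zero_le
    -- Since `(q - 1) p = q`, this normalises the test function to have `p`-th power integral `δ`.
    set c := (δ / I) ^ (1 / p) with hc
    have hcI : c * I = δ ^ (1 / p) * I ^ (1 / q) := by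
      rw [hc, ENNReal.div_rpow_of_nonneg _ _ (by positivity), div_eq_mul_inv, mul_assoc,
        ← ENNReal.rpow_neg]
      congr 1
      conv_lhs => rw [← ENNReal.rpow_one I, ← ENNReal.rpow_mul]
      rw [← ENNReal.rpow_add _ _ hI0 hItop]
      congr 1
      rw [hq]
      field_simp
      ring
    have h1 := hbound (fun x => c * T N x ^ (q - 1)) (((hTm N).pow_const _).const_mul c) (by
      simp_rw [ENNReal.mul_rpow_of_nonneg _ _ hp0.le, ← ENNReal.rpow_mul]
      have h2 : (q - 1) * p = q := by
        rw [hq]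
        field_simp
        ring
      rw [h2, lintegral_const_mul _ ((hTm N).pow_const q), hc, ← ENNReal.rpow_mul,
        one_div_mul_cancel hp0.ne', ENNReal.rpow_one]
      exact (ENNReal.div_mul_cancel hI0 hItop).le)
    have h3 : c * I ≤ B := by
      refine le_trans ?_ h1
      rw [hIdef, ← lintegral_const_mul _ ((hTm N).pow_const q)]
      refine lintegral_mono fun x => ?_
      rw [← hTpow, ← mul_assoc]
      gcongr
      exact min_le_left _ _
    rw [hcI] at h3
    have h4 : I ^ (1 / q) ≤ B / δ ^ (1 / p) := by
      rw [ENNReal.le_div_iff_mul_le (Or.inl (by simp [ENNReal.rpow_eq_zero_iff, hδ0, hδ]))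
        (Or.inl (ENNReal.rpow_ne_top_of_nonneg (by positivity) hδ)), mul_comm]
      exact h3
    calc I = (I ^ (1 / q)) ^ q := by
          rw [← ENNReal.rpow_mul, one_div_mul_cancel hq0.ne', ENNReal.rpow_one]
      _ ≤ _ := ENNReal.rpow_le_rpow h4 hq0.le
  have hsup : ∀ x, W x ^ q = ⨆ N, T N x ^ q := by
    intro x
    refine le_antisymm ?_ (iSup_le fun N => ENNReal.rpow_le_rpow (min_le_left _ _) hq0.le)
    rw [← ENNReal.le_rpow_inv_iff hq0]
    refine ENNReal.le_of_forall_nnreal_lt fun r hr => ?_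
    rw [ENNReal.le_rpow_inv_iff hq0]
    obtain ⟨N, hN⟩ := exists_nat_ge r
    refine le_iSup_of_le N (ENNReal.rpow_le_rpow (le_min hr.le ?_) hq0.le)
    exact_mod_cast hN
  have hle : ∫⁻ x, W x ^ q ∂μ ≤ (B / δ ^ (1 / p)) ^ q := by
    simp_rw [hsup]
    rw [lintegral_iSup (fun N => (hTm N).pow_const q)]
    · exact iSup_le hI
    · intro M N hMN x
      exact ENNReal.rpow_le_rpow (min_le_min_left _ (by exact_mod_cast hMN)) hq0.le
  refine ne_top_of_le_ne_top (ENNReal.rpow_ne_top_of_nonneg hq0.le (ENNReal.div_ne_top hB ?_)) hle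
  simp [ENNReal.rpow_eq_zero_iff, hδ0, hδ]

/-- The endpoint `p = 1`: the test function is the indicator of `{W > l}` scaled to have integral
`δ`, which forces `l δ ≤ B` unless the set is null. -/
theorem exists_ae_le_of_forall_lintegral_mul_ne_top [IsFiniteMeasure μ] {W : X → ℝ≥0∞}
    (hW : Measurable W)
    (H : ∀ h : X → ℝ≥0∞, Measurable h → ∫⁻ x, h x ∂μ ≠ ∞ → ∫⁻ x, h x * W x ∂μ ≠ ∞) :
    ∃ B : ℝ≥0, ∀ᵐ x ∂μ, W x ≤ B := by
  obtain ⟨δ, hδ0, hδ, B, hB, hbound⟩ :=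
    exists_lintegral_mul_le_of_forall_ne_top one_pos (μ := μ) (W := W) (by simpa using H)
  have hBδ : B / δ ≠ ∞ := ENNReal.div_ne_top hB hδ0
  have hlt : B / δ < (B / δ + 1).toNNReal := by
    rw [ENNReal.coe_toNNReal (by simp [hBδ])]
    exact ENNReal.lt_add_right hBδ one_ne_zero
  refine ⟨(B / δ + 1).toNNReal, ?_⟩
  set l : ℝ≥0∞ := ((B / δ + 1).toNNReal : ℝ≥0∞) with hl
  set E := {x | l < W x} with hE
  have hEm : MeasurableSet E := measurableSet_lt measurable_const hW
  have hE0 : μ E = 0 := by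
    by_contra hne
    have hint : ∫⁻ x, E.indicator (fun _ => δ / μ E) x ∂μ = δ := by
      rw [lintegral_indicator hEm, setLIntegral_const,
        ENNReal.div_mul_cancel hne (measure_ne_top _ _)]
    have h1 := hbound (E.indicator fun _ => δ / μ E) (measurable_const.indicator hEm) (by
      simp_rw [ENNReal.rpow_one]
      exact hint.le)
    have h2 : l * δ ≤ B := by
      refine le_trans ?_ h1
      calc l * δ = ∫⁻ x, l * E.indicator (fun _ => δ / μ E) x ∂μ := by
            rw [lintegral_const_mul _ (measurable_const.indicator hEm), hint]
        _ ≤ _ := lintegral_mono fun x => ?_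
      by_cases hx : x ∈ E
      · rw [mul_comm]
        gcongr
        exact (show l < W x from hx).le
      · simp [hx]
    rw [← ENNReal.le_div_iff_mul_le (Or.inl hδ0) (Or.inl hδ)] at h2
    exact absurd hlt (not_lt.2 h2)
  rw [ae_iff]
  simpa only [not_le] using hE0

end Duality

/-! ### Necessity of the class `D^T_p`. -/

/-- With `W = v^{-1/p}`, the map `h ↦ h W` carries `L^p` isometrically into `L^p_v`; the assumption
thus says `∫ h W < ∞` for all `h` in `L^p`, and duality puts `W` in `L^{p'}`. -/
theorem classD_of_forall_integrable {p : ℝ} (hp : 1 ≤ p) {v : Torus n → ℝ} (hv : IsWeight v)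
    (H : ∀ f : Torus n → ℂ, MemWeightedLp p v f → Integrable f) : ClassD p v := by
  have hp0 : 0 < p := by linarith
  rw [classD_iff hv]
  have hm : AEMeasurable (fun x => v x ^ (-(1 / p))) volume := hv.1.pow_const _
  set W : Torus n → ℝ≥0∞ := fun x => ‖hm.mk _ x‖ₑ with hWdef
  have hW : Measurable W := hm.measurable_mk.enorm
  have hWv : ∀ᵐ x, W x = ‖v x ^ (-(1 / p))‖ₑ := by
    filter_upwards [hm.ae_eq_mk] with x hx
    rw [hWdef, hx]
  have key : ∀ h : Torus n → ℝ≥0∞, Measurable h → ∫⁻ x, h x ^ p ≠ ∞ → ∫⁻ x, h x * W x ≠ ∞ := by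
    intro h hh hfin
    set f : Torus n → ℂ := fun x => (((h x * W x).toReal : ℝ) : ℂ) with hf
    have hfm : Measurable f := Complex.measurable_ofReal.comp (hh.mul hW).ennreal_toReal
    have hhtop : ∀ᵐ x, h x < ∞ := by
      filter_upwards [ae_lt_top (hh.pow_const p) hfin] with x hx
      exact (ENNReal.rpow_lt_top_iff_of_pos hp0).1 hx
    have hfn : ∀ᵐ x, ‖f x‖ₑ = h x * W x := by
      filter_upwards [hhtop] with x hx
      rw [hf, ← ofReal_norm, Complex.norm_real, Real.norm_of_nonneg ENNReal.toReal_nonneg,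
        ENNReal.ofReal_toReal (ENNReal.mul_ne_top hx.ne enorm_ne_top)]
    have hnorm : weightedNorm p v f ^ p = ∫⁻ x, h x ^ p := by
      rw [weightedNorm_rpow hp0 hv.2]
      refine lintegral_congr_ae ?_
      filter_upwards [hfn, hWv, hv.2] with x h1 h2 h3
      have h4 : W x ^ p * ENNReal.ofReal (v x) = 1 := by
        rw [h2, ← ofReal_norm, Real.norm_of_nonneg (by positivity),
          ENNReal.ofReal_rpow_of_nonneg (by positivity) hp0.le, ← Real.rpow_mul h3.le,
          ← ENNReal.ofReal_mul (by positivity), ← Real.rpow_add_one h3.ne', neg_mul,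
          one_div_mul_cancel hp0.ne']
        simp
      rw [h1, ENNReal.mul_rpow_of_nonneg _ _ hp0.le, mul_assoc, h4, mul_one]
    have hmem : MemWeightedLp p v f :=
      ⟨hfm.aestronglyMeasurable, (ENNReal.rpow_lt_top_iff_of_pos hp0).1 (hnorm ▸ hfin.lt_top)⟩
    rw [← lintegral_congr_ae hfn]
    exact (H f hmem).2.ne
  rcases hp.eq_or_lt with rfl | hp1
  · obtain ⟨B, hB⟩ := exists_ae_le_of_forall_lintegral_mul_ne_top hW
      (by simpa only [ENNReal.rpow_one] using key)
    have hq : ENNReal.conjExponent (ENNReal.ofReal 1) = ∞ := by simp [ENNReal.conjExponent]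
    rw [hq]
    refine memLp_top_of_bound hm.aestronglyMeasurable B ?_
    filter_upwards [hB, hWv] with x h1 h2
    rw [h2] at h1
    exact_mod_cast h1
  · have h := lintegral_rpow_conj_ne_top hp1 hW key
    have hp2 : 0 < p - 1 := by linarith
    rw [conjExponent_ofReal hp1]
    have hq0 : 0 < p / (p - 1) := by positivity
    refine ⟨hm.aestronglyMeasurable, ?_⟩
    rw [eLpNorm_lt_top_iff_lintegral_rpow_enorm_lt_top (by simpa using hq0) (by simp),
      ENNReal.toReal_ofReal hq0.le]
    refine (lintegral_congr_ae ?_).trans_lt h.lt_top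
    filter_upwards [hWv] with x hx
    rw [hx]

theorem ae_lt_top_of_mapsStrong {p : ℝ} (hp : 0 < p) {v u : Torus n → ℝ} (hu : IsWeight u)
    {S : (Torus n → ℂ) → Torus n → ℝ≥0∞} (hS : MapsStrong p v u S) {f : Torus n → ℂ}
    (hf : MemWeightedLp p v f) : ∀ᵐ x, S f x < ∞ := by
  obtain ⟨C, hC⟩ := hS
  obtain ⟨⟨hm, hlt⟩, -⟩ := hC f hf
  have h := weightedNorm_rpow hp hu.2 (S f)
  have h2 := ae_lt_top' ((hm.aemeasurable.pow_const p).mul hu.1.ennreal_ofReal)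
    (h ▸ ENNReal.rpow_ne_top_of_nonneg hp.le hlt.ne)
  filter_upwards [h2, hu.2] with x hx hux
  by_contra hcon
  rw [not_lt, top_le_iff] at hcon
  rw [Pi.mul_apply, hcon, ENNReal.top_rpow_of_pos hp, ENNReal.top_mul (by simpa using hux)] at hx
  exact lt_irrefl _ hx

theorem ae_lt_top_of_mapsWeak {v u : Torus n → ℝ} (hu : IsWeight u)
    {S : (Torus n → ℂ) → Torus n → ℝ≥0∞} (hS : MapsWeak 1 v u S) {f : Torus n → ℂ}
    (hf : MemWeightedLp 1 v f) : ∀ᵐ x, S f x < ∞ := by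
  obtain ⟨C, hC⟩ := hS
  obtain ⟨-, hl⟩ := hC f hf
  simp only [ENNReal.rpow_one] at hl
  set E := {x | S f x = ∞} with hE
  have hE0 : weightMeasure u E = 0 := by
    by_contra hne
    -- The set where `S f = ∞` lies in every level set, so `m · u(E)` stays below a fixed finite
    -- bound for all `m`.
    obtain ⟨m, hm⟩ := ENNReal.exists_nat_mul_gt hne
      (ENNReal.mul_ne_top (ENNReal.coe_ne_top (r := C)) hf.2.ne)
    refine absurd (hl m) (not_le.2 (hm.trans_le ?_))
    rw [ENNReal.coe_natCast]
    gcongr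
    intro x hx
    rw [Set.mem_ofPred_eq, show S f x = ∞ from hx]
    exact ENNReal.natCast_lt_top m
  rw [weightMeasure, withDensity_apply_eq_zero' hu.1.ennreal_ofReal] at hE0
  have h : ∀ᵐ x, x ∉ {x | ENNReal.ofReal (u x) ≠ 0} ∩ E := measure_eq_zero_iff_ae_notMem.1 hE0
  filter_upwards [h, hu.2] with x hx hux
  rw [lt_top_iff_ne_top]
  exact fun hS => hx ⟨(ENNReal.ofReal_pos.2 hux).ne', hS⟩

theorem exists_of_ae {P : Torus n → Prop} (h : ∀ᵐ x, P x) : ∃ x, P x := by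
  by_contra hcon
  have h0 : (volume : Measure (Torus n)) Set.univ = 0 := by
    refine measure_mono_null (fun x _ => ?_) (ae_iff.1 h)
    exact fun hx => hcon ⟨x, hx⟩
  rw [volume_torus_univ] at h0
  exact one_ne_zero h0

/-- Here the convention that divergent convolutions count as `∞` is essential: with the default
value zero, a finite supremum would say nothing about convergence. -/
theorem heatConvFinite_of_heatMaximal_lt_top {R t : ℝ} {f : Torus n → ℂ} {x : Torus n}
    (h : heatMaximal R f x < ∞) (ht : t ∈ Set.Ioo 0 R) : HeatConvFinite t f x := by
  by_contra hcon
  refine absurd h (not_lt.2 ?_)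
  refine le_iSup₂_of_le t ht ?_
  rw [if_neg hcon]

end TorusHeat

/-! ### The equivalences. -/

theorem theorem4p3 (n : ℕ) (p : ℝ) (hp : 1 ≤ p) (v : TorusHeat.Torus n → ℝ)
    (hv : TorusHeat.IsWeight v) :
    List.TFAE [
      TorusHeat.ClassD p v,
      ∃ R : ℝ, 0 < R ∧ R < 1 / 2 ∧ ∃ u : TorusHeat.Torus n → ℝ, TorusHeat.IsWeight u ∧
        (1 < p → TorusHeat.MapsStrong p v u (TorusHeat.heatMaximal R)) ∧
        (p = 1 → TorusHeat.MapsWeak p v u (TorusHeat.heatMaximal R)),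
      ∃ R : ℝ, 0 < R ∧ R < 1 / 2 ∧ ∀ f : TorusHeat.Torus n → ℂ, TorusHeat.MemWeightedLp p v f →
        (∀ᵐ x, TorusHeat.HeatConvFinite R f x) ∧
        ∀ᵐ x, Tendsto (fun t : ℝ => TorusHeat.heatConv t f x) (𝓝[>] 0) (𝓝 (f x)),
      ∃ R : ℝ, 0 < R ∧ R < 1 / 2 ∧ ∀ f : TorusHeat.Torus n → ℂ, TorusHeat.MemWeightedLp p v f →
        ∀ᵐ x, TorusHeat.heatMaximal R f x < ∞] := by
  tfae_have 1 → 2 := by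
    intro hD
    refine ⟨1 / 4, by norm_num, by norm_num, ?_⟩
    rcases hp.eq_or_lt with rfl | hp1
    · exact ⟨fun _ => 1, ⟨aemeasurable_const, by simp⟩, fun h => absurd h (lt_irrefl _),
        fun _ => TorusHeat.mapsWeak_one hv hD (by norm_num)⟩
    · obtain ⟨u, hu, hS⟩ := TorusHeat.exists_mapsStrong hp1 hv hD (R := 1 / 4) (by norm_num)
      exact ⟨u, hu, fun _ => hS, fun h => absurd h hp1.ne'⟩
  tfae_have 2 → 4 := by
    rintro ⟨R, hR0, hR, u, hu, hs, hw⟩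
    refine ⟨R, hR0, hR, fun f hf => ?_⟩
    rcases hp.eq_or_lt with rfl | hp1
    · exact TorusHeat.ae_lt_top_of_mapsWeak hu (hw rfl) hf
    · exact TorusHeat.ae_lt_top_of_mapsStrong (by linarith) hu (hs hp1) hf
  tfae_have 4 → 1 := by
    rintro ⟨R, hR0, hR, H⟩
    refine TorusHeat.classD_of_forall_integrable hp hv fun f hf => ?_
    obtain ⟨x, hx⟩ := TorusHeat.exists_of_ae (H f hf)
    -- The supremum runs over the open interval `(0, R)`; `R / 2` is one admissible time.
    exact TorusHeat.integrable_of_heatConvFinite hf.1 (half_pos hR0)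
      (TorusHeat.heatConvFinite_of_heatMaximal_lt_top hx ⟨half_pos hR0, half_lt_self hR0⟩)
  tfae_have 1 → 3 := by
    intro hD
    refine ⟨1 / 4, by norm_num, by norm_num, fun f hf => ?_⟩
    have hfi := TorusHeat.integrable_of_memWeightedLp hp hv hD hf
    exact ⟨Eventually.of_forall fun x => TorusHeat.heatConvFinite_of_integrable hfi (by norm_num) x,
      TorusHeat.ae_tendsto_heatConv hfi⟩
  tfae_have 3 → 1 := by
    rintro ⟨R, hR0, hR, H⟩
    refine TorusHeat.classD_of_forall_integrable hp hv fun f hf => ?_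
    obtain ⟨x, hx⟩ := TorusHeat.exists_of_ae (H f hf).1
    exact TorusHeat.integrable_of_heatConvFinite hf.1 hR0 hx
  tfae_finish
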